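/- Let $n\in\mathbb N$, let $T^n=\mathbb R^n/\mathbb Z^n$, let $F\ge 0$, and let $\varphi\colon T^n\times\mathbb R\to\mathbb R$ be Lipschitz continuous, with $\varphi(x,y+1)=\varphi(x,y)$ for all $x,y$ and $\int_{T^n\times[0,1)}\varphi=0$. Consider the equation $$g_t(x,t)=-(-\Delta)^{1/2}g(x,t)+\varphi(x,g(x,t))+F, \qquad x\in T^n, \tag{E}$$ where $(-\Delta)^{1/2}$ is the Fourier multiplier with symbol $|2\pi k|$, $k\in\mathbb Z^n$: for continuous $u,v$ on $T^n$, $v=(-\Delta)^{1/2}u$ means $\hat v(k)=|2\pi k|\,\hat u(k)$ for all $k\in\mathbb Z^n$. For an open set $J\subset\mathbb R$, $g$ is a classical solution of (E) for $t\in J$ if $g$ is of class $C^1$ in $(x,t)$ on $T^n\times J$, $(-\Delta)^{1/2}g(\cdot,t)$ exists for each $t\in J$ and is continuous in $(x,t)$ on $T^n\times J$, and (E) holds at every point of $T^n\times J$. Classical subsolutions and supersolutions on $[0,T)$ are continuous functions on $T^n\times[0,T)$ which have this regularity for $t\in(0,T)$ and satisfy (E) there with $=$ replaced by $\le$ and $\ge$,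 respectively. 1. For every continuous $g_0\colon T^n\to\mathbb R$ there is exactly one continuous function $g$ on $T^n\times[0,\infty)$ with $g(\cdot,0)=g_0$ that is a classical solution of (E) for $t\in(0,\infty)$. 2. (Comparison principle.) Let $T>0$, let $u$ be a classical subsolution and $v$ a classical supersolution on $[0,T)$ (for instance, two classical solutions), with $u(\cdot,0)\le v(\cdot,0)$ on $T^n$. Then $u(x,t)\le v(x,t)$ for all $x\in T^n$ and $t\in[0,T)$. 3. For every $g_0\in L^2(T^n)$ there is a mild solution of (E) with initial condition $g_0$, that is, a $g\in C([0,\infty);L^2(T^n))$ such that for all $t\ge 0$ and $k\in\mathbb Z^n$ $$\hat g(k,t)=e^{-|2\pi k|t}\,\hat g_0(k)+\int_0^t e^{-|2\pi k|(t-s)}\,\hat f_s(k)\,ds,\qquad f_s(x)=\varphi(x,g(x,s))+F.$$ Every such mild solution is classical for $t>0$: there is a classical solution $h$ of (E) for $t\in(0,\infty)$ such that $g(\cdot,t)=h(\cdot,t)$ almost everywhere on $T^n$ for each $t>0$. -/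

import Mathlib

open MeasureTheory Set Filter Topology
open scoped ENNReal

noncomputable section

namespace HalfLaplaceFlow

/-- The `n`-dimensional torus `ℝⁿ / ℤⁿ`. -/
abbrev Torus (n : ℕ) : Type := UnitAddTorus (Fin n)

/-- Lebesgue measure on `ℝⁿ / ℤⁿ`, of total mass `1`, written as the product of the normalized
Haar measures of the circle (the form in which Mathlib's multivariate Fourier series use it). -/
abbrev Torus.measure (n : ℕ) : Measure (Torus n) :=
  Measure.pi (fun _ => (AddCircle.haarAddCircle : Measure UnitAddCircle))

/-- The real Hilbert space `L²(Tⁿ)`. -/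
abbrev L2 (n : ℕ) : Type := Lp ℝ 2 (Torus.measure n)

/-- The projection `ℝⁿ → ℝⁿ / ℤⁿ`. -/
def Torus.mk {n : ℕ} (y : Fin n → ℝ) : Torus n := fun i => (y i : UnitAddCircle)

/-- The `k`-th Fourier coefficient `∫ u(x) exp(-2πi k·x) dx` of a real-valued function on the
torus. -/
def torusFourierCoeff {n : ℕ} (u : Torus n → ℝ) (k : Fin n → ℤ) : ℂ :=
  UnitAddTorus.mFourierCoeff (fun x => (u x : ℂ)) k

/-- The symbol `|2πk|` of `(-Δ)^{1/2}` on `ℝⁿ / ℤⁿ`, where `|·|` is the Euclidean norm. -/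
def halfLaplaceSymbol {n : ℕ} (k : Fin n → ℤ) : ℝ :=
  2 * Real.pi * Real.sqrt (∑ i, (k i : ℝ) ^ 2)

/-- `v = (-Δ)^{1/2} u`, for continuous functions `u` and `v` on the torus: `v` is the (unique)
continuous function whose Fourier coefficients are `|2πk| û(k)`. -/
structure IsHalfLaplacian {n : ℕ} (u v : Torus n → ℝ) : Prop where
  continuous_left : Continuous u
  continuous_right : Continuous v
  coeff : ∀ k : Fin n → ℤ, torusFourierCoeff v k = (halfLaplaceSymbol k : ℂ) * torusFourierCoeff u k

/-- The assumptions on the force `φ : Tⁿ × ℝ → ℝ`: it is `1`-periodic in the second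
variable, has vanishing average, and is Lipschitz continuous in both variables. -/
structure IsPinningForce {n : ℕ} (φ : Torus n → ℝ → ℝ) : Prop where
  periodic : ∀ x y, φ x (y + 1) = φ x y
  average_zero :
    ∫ p in (univ : Set (Torus n)) ×ˢ Ico (0 : ℝ) 1, φ p.1 p.2 ∂((Torus.measure n).prod volume) = 0
  lipschitz : ∃ K : NNReal, LipschitzWith K (fun p : Torus n × ℝ => φ p.1 p.2)

/-- `g(x, t)` (written `g t x`) is of class `C¹` in `(x, t)` and `(-Δ)^{1/2} g(·, t)` exists as a
continuous function of `(x, t)`, for `x ∈ Tⁿ` and `t` in the open set of times `J`; and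
`g_t  R  -(-Δ)^{1/2} g + φ(x, g) + F` holds at every such `(x, t)`, where `R` is one of the
relations `=`, `≤`, `≥`. -/
def ClassicalRel (R : ℝ → ℝ → Prop) {n : ℕ} (φ : Torus n → ℝ → ℝ) (F : ℝ) (J : Set ℝ)
    (g : ℝ → Torus n → ℝ) : Prop :=
  ContDiffOn ℝ 1 (fun p : ℝ × (Fin n → ℝ) => g p.1 (Torus.mk p.2)) (J ×ˢ univ) ∧
  ∃ h : ℝ → Torus n → ℝ,
    ContinuousOn (fun p : ℝ × Torus n => h p.1 p.2) (J ×ˢ univ) ∧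
    ∀ t ∈ J, IsHalfLaplacian (g t) (h t) ∧
      ∀ x, R (deriv (fun s => g s x) t) (-h t x + φ x (g t x) + F)

/-- `g` is a classical solution of `g_t = -(-Δ)^{1/2} g + φ(x, g) + F` at the times `t ∈ J`. -/
def IsClassicalSolutionOn {n : ℕ} (φ : Torus n → ℝ → ℝ) (F : ℝ) (J : Set ℝ)
    (g : ℝ → Torus n → ℝ) : Prop :=
  ClassicalRel (fun a b => a = b) φ F J g

/-- `g` is a global in time classical solution with initial condition `g(·, 0) = g₀`: it is
continuous on `Tⁿ × [0, ∞)` and a classical solution for all `t > 0`. -/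
structure IsGlobalClassicalSolution {n : ℕ} (φ : Torus n → ℝ → ℝ) (F : ℝ) (g₀ : Torus n → ℝ)
    (g : ℝ → Torus n → ℝ) : Prop where
  continuousOn : ContinuousOn (fun p : ℝ × Torus n => g p.1 p.2) (Ici 0 ×ˢ univ)
  initial : g 0 = g₀
  solution : IsClassicalSolutionOn φ F (Ioi 0) g

/-- `g` is a classical subsolution on the time interval `[0, T)`. -/
structure IsClassicalSubsolution {n : ℕ} (φ : Torus n → ℝ → ℝ) (F T : ℝ)
    (g : ℝ → Torus n → ℝ) : Prop where
  continuousOn : ContinuousOn (fun p : ℝ × Torus n => g p.1 p.2) (Ico 0 T ×ˢ univ)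
  subsolution : ClassicalRel (fun a b => a ≤ b) φ F (Ioo 0 T) g

/-- `g` is a classical supersolution on the time interval `[0, T)`. -/
structure IsClassicalSupersolution {n : ℕ} (φ : Torus n → ℝ → ℝ) (F T : ℝ)
    (g : ℝ → Torus n → ℝ) : Prop where
  continuousOn : ContinuousOn (fun p : ℝ × Torus n => g p.1 p.2) (Ico 0 T ×ˢ univ)
  supersolution : ClassicalRel (fun a b => a ≥ b) φ F (Ioo 0 T) g

/-- `g` is a global mild solution with initial condition `g₀ ∈ L²(Tⁿ)`: a continuous curve
`[0, ∞) → L²(Tⁿ)` that satisfies the variation of constants formula, written here for each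
Fourier coefficient. -/
structure IsMildSolution {n : ℕ} (φ : Torus n → ℝ → ℝ) (F : ℝ) (g₀ : L2 n)
    (g : ℝ → L2 n) : Prop where
  continuousOn : ContinuousOn g (Ici 0)
  duhamel : ∀ t : ℝ, 0 ≤ t → ∀ k : Fin n → ℤ,
    torusFourierCoeff (g t) k = (Real.exp (-(halfLaplaceSymbol k * t)) : ℂ) * torusFourierCoeff g₀ k +
      ∫ s in (0 : ℝ)..t, (Real.exp (-(halfLaplaceSymbol k * (t - s))) : ℂ) *
        torusFourierCoeff (fun x => φ x (g s x) + F) k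

end HalfLaplaceFlow

end

noncomputable section

namespace HalfLaplaceFlow

open ProbabilityTheory

section Subordination

variable {c : ℝ}

lemma hasDerivAt_sub_const_div {y : ℝ} (hy : y ≠ 0) :
    HasDerivAt (fun y => y - c / y) (1 + c / y ^ 2) y := by
  have h := (hasDerivAt_id y).sub ((hasDerivAt_const y c).div (hasDerivAt_id y) hy)
  refine h.congr_deriv ?_
  simp only [id]
  ring

lemma injOn_sub_const_div (hc : 0 < c) : InjOn (fun y => y - c / y) (Ioi 0) := by
  intro x hx y hy h
  simp only [mem_Ioi] at hx hy
  simp only at h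
  field_simp at h
  have : (x - y) * (x * y + c) = 0 := by linear_combination h
  rcases mul_eq_zero.1 this with h | h
  · linarith
  · have := mul_pos hx hy
    linarith

lemma image_sub_const_div (hc : 0 < c) : (fun y => y - c / y) '' Ioi 0 = univ := by
  refine eq_univ_of_forall fun x => ?_
  have hs : √(x ^ 2 + 4 * c) ^ 2 = x ^ 2 + 4 * c := Real.sq_sqrt (by positivity)
  have hlt : |x| < √(x ^ 2 + 4 * c) := by
    rw [← Real.sqrt_sq_eq_abs]
    exact Real.sqrt_lt_sqrt (sq_nonneg x) (by linarith)
  have hpos : 0 < (x + √(x ^ 2 + 4 * c)) / 2 := by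
    have := neg_abs_le x
    linarith
  refine ⟨(x + √(x ^ 2 + 4 * c)) / 2, hpos, ?_⟩
  have : x + √(x ^ 2 + 4 * c) ≠ 0 := by linarith
  simp only
  field_simp
  linear_combination hs

lemma hasDerivAt_const_div {y : ℝ} (hy : y ≠ 0) :
    HasDerivAt (fun y => c / y) (-(c / y ^ 2)) y := by
  have h := (hasDerivAt_const y c).div (hasDerivAt_id y) hy
  refine h.congr_deriv ?_
  simp only [id]
  ring

lemma injOn_const_div (hc : 0 < c) : InjOn (fun y => c / y) (Ioi 0) := by
  intro x hx y hy h
  simp only [mem_Ioi] at hx hy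
  simp only at h
  field_simp at h
  exact h.symm

lemma image_const_div (hc : 0 < c) : (fun y => c / y) '' Ioi 0 = Ioi 0 := by
  ext x
  constructor
  · rintro ⟨y, hy, rfl⟩
    exact div_pos hc hy
  · intro hx
    have hx' : 0 < x := hx
    exact ⟨c / x, div_pos hc hx, by simp only; field_simp⟩

lemma abs_neg_const_div_sq (hc : 0 < c) (y : ℝ) : |-(c / y ^ 2)| = c / y ^ 2 := by
  rw [abs_neg, abs_of_nonneg (by positivity)]

lemma integral_Ioi_comp_const_div (hc : 0 < c) (g : ℝ → ℝ) :
    ∫ y in Ioi (0 : ℝ), c / y ^ 2 * g (c / y) = ∫ y in Ioi (0 : ℝ), g y := by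
  have h := integral_image_eq_integral_abs_deriv_smul measurableSet_Ioi
    (fun y (hy : y ∈ Ioi (0 : ℝ)) =>
      (hasDerivAt_const_div (c := c) (ne_of_gt hy)).hasDerivWithinAt)
    (injOn_const_div hc) g
  rw [image_const_div hc] at h
  simp only [abs_neg_const_div_sq hc, smul_eq_mul] at h
  exact h.symm

lemma integrableOn_Ioi_comp_const_div (hc : 0 < c) {g : ℝ → ℝ} (hg : IntegrableOn g (Ioi 0)) :
    IntegrableOn (fun y => c / y ^ 2 * g (c / y)) (Ioi 0) := by
  have h := integrableOn_image_iff_integrableOn_abs_deriv_smul measurableSet_Ioi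
    (fun y (hy : y ∈ Ioi (0 : ℝ)) =>
      (hasDerivAt_const_div (c := c) (ne_of_gt hy)).hasDerivWithinAt)
    (injOn_const_div hc) g
  rw [image_const_div hc] at h
  simp only [abs_neg_const_div_sq hc, smul_eq_mul] at h
  exact h.1 hg

lemma continuousOn_comp_sub_const_div {F : ℝ → ℝ} (hF : Continuous F) :
    ContinuousOn (fun y => F (y - c / y)) (Ioi 0) :=
  hF.comp_continuousOn fun _ hy =>
    (hasDerivAt_sub_const_div (ne_of_gt hy)).continuousAt.continuousWithinAt

lemma integrableOn_deriv_mul_comp_sub_const_div (hc : 0 < c) {F : ℝ → ℝ} (hF : Integrable F) :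
    IntegrableOn (fun y => (1 + c / y ^ 2) * F (y - c / y)) (Ioi 0) := by
  have h := integrableOn_image_iff_integrableOn_abs_deriv_smul measurableSet_Ioi
    (fun y (hy : y ∈ Ioi (0 : ℝ)) =>
      (hasDerivAt_sub_const_div (c := c) (ne_of_gt hy)).hasDerivWithinAt)
    (injOn_sub_const_div hc) F
  rw [image_sub_const_div hc, integrableOn_univ] at h
  refine (h.1 hF).congr_fun (fun y hy => ?_) measurableSet_Ioi
  simp only [smul_eq_mul]
  rw [abs_of_nonneg (by positivity)]

lemma integral_deriv_mul_comp_sub_const_div (hc : 0 < c) (F : ℝ → ℝ) :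
    ∫ y in Ioi (0 : ℝ), (1 + c / y ^ 2) * F (y - c / y) = ∫ x, F x := by
  have h := integral_image_eq_integral_abs_deriv_smul measurableSet_Ioi
    (fun y (hy : y ∈ Ioi (0 : ℝ)) =>
      (hasDerivAt_sub_const_div (c := c) (ne_of_gt hy)).hasDerivWithinAt)
    (injOn_sub_const_div hc) F
  rw [image_sub_const_div hc, setIntegral_univ] at h
  rw [h]
  refine setIntegral_congr_fun measurableSet_Ioi fun y hy => ?_
  simp only [smul_eq_mul]
  rw [abs_of_nonneg (by positivity)]

lemma integrableOn_comp_sub_const_div (hc : 0 < c) {F : ℝ → ℝ} (hF : Integrable F)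
    (hFc : Continuous F) : IntegrableOn (fun y => F (y - c / y)) (Ioi 0) := by
  refine Integrable.mono (integrableOn_deriv_mul_comp_sub_const_div hc hF)
    ((continuousOn_comp_sub_const_div hFc).aestronglyMeasurable measurableSet_Ioi) ?_
  refine ae_of_all _ fun y => ?_
  rw [norm_mul]
  refine le_mul_of_one_le_left (norm_nonneg _) ?_
  rw [Real.norm_of_nonneg (by positivity)]
  have : 0 ≤ c / y ^ 2 := by positivity
  linarith

/-- The Cauchy-Schlömilch substitution. -/
lemma integral_comp_sub_const_div (hc : 0 < c) {F : ℝ → ℝ} (hF : Integrable F)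
    (hFc : Continuous F) (heven : ∀ x, F (-x) = F x) :
    2 * ∫ y in Ioi (0 : ℝ), F (y - c / y) = ∫ x, F x := by
  have h1 := integrableOn_comp_sub_const_div hc hF hFc
  have h2 := integral_Ioi_comp_const_div hc fun y => F (y - c / y)
  have h3 := integrableOn_Ioi_comp_const_div hc h1
  have hinv : ∀ y ∈ Ioi (0 : ℝ), c / y ^ 2 * F (c / y - c / (c / y)) =
      c / y ^ 2 * F (y - c / y) := by
    intro y hy
    have : c / (c / y) = y := by field_simp
    rw [this, ← heven, neg_sub]
  rw [setIntegral_congr_fun measurableSet_Ioi hinv] at h2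
  replace h3 := h3.congr_fun hinv measurableSet_Ioi
  rw [← integral_deriv_mul_comp_sub_const_div hc F]
  simp only [add_mul, one_mul]
  rw [integral_add h1 h3, h2, two_mul]

end Subordination

section Gaussian

/-- The standard Gaussian density. -/
abbrev stdPdf : ℝ → ℝ := gaussianPDFReal 0 1

/-- The standard Gaussian measure on `ℝ`. -/
abbrev stdGauss : Measure ℝ := gaussianReal 0 1

lemma stdPdf_eq (x : ℝ) : stdPdf x = (√(2 * Real.pi))⁻¹ * Real.exp (-x ^ 2 / 2) := by
  simp [stdPdf, gaussianPDFReal]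

lemma continuous_stdPdf : Continuous stdPdf := by
  have : stdPdf = fun x => (√(2 * Real.pi))⁻¹ * Real.exp (-x ^ 2 / 2) := funext stdPdf_eq
  rw [this]
  fun_prop

lemma stdPdf_neg (x : ℝ) : stdPdf (-x) = stdPdf x := by
  simp [stdPdf_eq]

lemma stdPdf_mul_exp (c : ℝ) {y : ℝ} (hy : y ≠ 0) :
    stdPdf y * Real.exp (-(c / y) ^ 2 / 2) = Real.exp (-c) * stdPdf (y - c / y) := by
  rw [stdPdf_eq, stdPdf_eq, mul_assoc, ← Real.exp_add, mul_left_comm, ← Real.exp_add]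
  congr 2
  field_simp
  ring

lemma integral_stdGauss (f : ℝ → ℝ) : ∫ x, f x ∂stdGauss = ∫ x, stdPdf x * f x := by
  simp [stdGauss, integral_gaussianReal_eq_integral_smul]

lemma integrable_stdGauss_iff {f : ℝ → ℝ} :
    Integrable f stdGauss ↔ Integrable fun x => stdPdf x * f x := by
  rw [stdGauss, gaussianReal_of_var_ne_zero 0 one_ne_zero,
    integrable_withDensity_iff_integrable_smul' (measurable_gaussianPDF 0 1)
      (ae_of_all _ fun x => gaussianPDF_lt_top)]
  simp [stdPdf]

lemma integrable_sq_stdGauss : Integrable (fun x : ℝ => x ^ 2) stdGauss :=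
  (memLp_id_gaussianReal' (μ := 0) (v := 1) 2 (by simp)).integrable_sq

lemma integral_sq_stdGauss : ∫ x, x ^ 2 ∂stdGauss = 1 := by
  have h := variance_fun_id_gaussianReal (μ := 0) (v := 1)
  rw [variance_eq_integral (by fun_prop)] at h
  simpa [integral_id_gaussianReal] using h

lemma integral_even_mul_exp (c : ℝ) {f : ℝ → ℝ} (hf : ∀ x, f (-x) = f x) :
    ∫ y, f y * Real.exp (-(c / y) ^ 2 / 2) ∂stdGauss =
      Real.exp (-c) * (2 * ∫ y in Ioi (0 : ℝ), f y * stdPdf (y - c / y)) := by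
  rw [integral_stdGauss]
  have h1 : (fun y => stdPdf y * (f y * Real.exp (-(c / y) ^ 2 / 2))) =
      fun y => (fun y => stdPdf y * (f y * Real.exp (-(c / y) ^ 2 / 2))) |y| := by
    funext y
    rcases abs_cases y with ⟨h, -⟩ | ⟨h, -⟩
    · simp only [h]
    · simp only [h, stdPdf_neg, hf, div_neg, even_two, Even.neg_pow]
  rw [h1, integral_comp_abs (f := fun y => stdPdf y * (f y * Real.exp (-(c / y) ^ 2 / 2))),
    mul_left_comm]
  congr 1
  rw [← integral_const_mul]
  refine setIntegral_congr_fun measurableSet_Ioi fun y hy => ?_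
  have h := stdPdf_mul_exp c (ne_of_gt (mem_Ioi.1 hy))
  linear_combination f y * h

/-- Subordination of the Poisson kernel to the heat kernel. -/
lemma integral_exp_stdGauss {c : ℝ} (hc : 0 ≤ c) :
    ∫ y, Real.exp (-(c / y) ^ 2 / 2) ∂stdGauss = Real.exp (-c) := by
  rcases hc.eq_or_lt with rfl | hc
  · simp
  have h := integral_even_mul_exp c (f := fun _ => 1) fun _ => rfl
  simp only [one_mul] at h
  rw [h, integral_comp_sub_const_div hc (integrable_gaussianPDFReal 0 1) continuous_stdPdf
    stdPdf_neg, integral_gaussianPDFReal_eq_one 0 one_ne_zero, mul_one]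

lemma integral_sq_sub_one_mul_exp_stdGauss {c : ℝ} (hc : 0 ≤ c) :
    ∫ y, (y ^ 2 - 1) * Real.exp (-(c / y) ^ 2 / 2) ∂stdGauss = c * Real.exp (-c) := by
  rcases hc.eq_or_lt with rfl | hc
  · have : ∫ y, (y ^ 2 - 1) ∂stdGauss = 0 := by
      rw [integral_sub integrable_sq_stdGauss (integrable_const _), integral_sq_stdGauss]
      simp
    simpa using this
  rw [integral_even_mul_exp c (f := fun y => y ^ 2 - 1) (by simp)]
  have i0 : IntegrableOn (fun y => stdPdf (y - c / y)) (Ioi 0) :=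
    integrableOn_comp_sub_const_div hc (integrable_gaussianPDFReal 0 1) continuous_stdPdf
  have e0 : 2 * ∫ y in Ioi (0 : ℝ), stdPdf (y - c / y) = 1 := by
    rw [integral_comp_sub_const_div hc (integrable_gaussianPDFReal 0 1) continuous_stdPdf
      stdPdf_neg, integral_gaussianPDFReal_eq_one 0 one_ne_zero]
  have hFi : Integrable (fun x => stdPdf x * x ^ 2) :=
    integrable_stdGauss_iff.1 integrable_sq_stdGauss
  have hFc : Continuous (fun x => stdPdf x * x ^ 2) := continuous_stdPdf.mul (by fun_prop)
  have i2 := integrableOn_comp_sub_const_div hc hFi hFc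
  have e2 := integral_comp_sub_const_div hc hFi hFc (by simp [stdPdf_neg])
  rw [← integral_stdGauss, integral_sq_stdGauss] at e2
  have hinv : ∀ y ∈ Ioi (0 : ℝ), c / y ^ 2 * stdPdf (c / y - c / (c / y)) =
      c / y ^ 2 * stdPdf (y - c / y) := by
    intro y hy
    have : c / (c / y) = y := by field_simp
    rw [this, ← stdPdf_neg, neg_sub]
  have i1 := (integrableOn_Ioi_comp_const_div hc i0).congr_fun hinv measurableSet_Ioi
  have e1 := integral_Ioi_comp_const_div hc fun y => stdPdf (y - c / y)
  rw [setIntegral_congr_fun measurableSet_Ioi hinv] at e1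
  have key : ∫ y in Ioi (0 : ℝ), (y ^ 2 - 1) * stdPdf (y - c / y) =
      (∫ y in Ioi (0 : ℝ), stdPdf (y - c / y) * (y - c / y) ^ 2) +
        (2 * c - 1) * (∫ y in Ioi (0 : ℝ), stdPdf (y - c / y)) -
        c * ∫ y in Ioi (0 : ℝ), c / y ^ 2 * stdPdf (y - c / y) := by
    have i3 : IntegrableOn (fun y => stdPdf (y - c / y) * (y - c / y) ^ 2 +
        (2 * c - 1) * stdPdf (y - c / y)) (Ioi 0) := i2.add (i0.const_mul _)
    rw [← integral_const_mul, ← integral_const_mul, ← integral_add i2 (i0.const_mul _),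
      ← integral_sub i3 (i1.const_mul _)]
    refine setIntegral_congr_fun measurableSet_Ioi fun y hy => ?_
    have hy' : y ≠ 0 := ne_of_gt hy
    field_simp
    ring
  rw [key, e1]
  linear_combination Real.exp (-c) * (e2 + (2 * c - 1 - c) * e0)

lemma integral_cexp_stdGauss (η : ℝ) :
    ∫ x, Complex.exp (Complex.I * (η * x)) ∂stdGauss = Complex.exp (-η ^ 2 / 2) := by
  have h := complexMGF_id_gaussianReal (μ := 0) (v := 1) (Complex.I * η)
  simp only [complexMGF, id] at h
  simp only [← mul_assoc]
  rw [h]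
  congr 1
  simp [mul_pow]

lemma integral_mul_cexp_stdGauss (η : ℝ) :
    ∫ x, (x : ℂ) * Complex.exp (Complex.I * (η * x)) ∂stdGauss =
      Complex.I * η * Complex.exp (-η ^ 2 / 2) := by
  have h := hasDerivAt_complexMGF (X := id) (μ := stdGauss) (z := Complex.I * η)
    (by simp [integrableExpSet_id_gaussianReal])
  have h2 : complexMGF id stdGauss = fun z => Complex.exp (z ^ 2 / 2) := by
    funext z
    simpa using complexMGF_id_gaussianReal (μ := 0) (v := 1) z
  rw [h2] at h
  have h3 := (((hasDerivAt_id (Complex.I * η)).pow 2).div_const 2).cexp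
  have h4 := h.unique h3
  simp only [id, ← mul_assoc] at h4 ⊢
  rw [h4]
  simp [mul_pow]
  ring

end Gaussian

section Weights

/-- The law of a standard Gaussian vector in `ℝⁿ` and an independent standard Gaussian variable.
The quotient of the two has a Cauchy distribution. -/
abbrev gaussPair (n : ℕ) : Measure ((Fin n → ℝ) × ℝ) :=
  (Measure.pi fun _ => stdGauss).prod stdGauss

lemma ae_ne_zero_stdGauss : ∀ᵐ y ∂stdGauss, y ≠ 0 := by
  have := nullSingletonClass_gaussianReal (μ := 0) (v := 1) one_ne_zero
  exact compl_mem_ae_iff.2 (measure_singleton 0)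

lemma integral_cexp_pi_stdGauss {n : ℕ} (η : Fin n → ℝ) :
    ∫ z : Fin n → ℝ, Complex.exp (Complex.I * ((∑ i, η i * z i : ℝ) : ℂ))
      ∂(Measure.pi fun _ => stdGauss) = (Real.exp (-(∑ i, η i ^ 2) / 2) : ℂ) := by
  have h : ∀ z : Fin n → ℝ, Complex.exp (Complex.I * ((∑ i, η i * z i : ℝ) : ℂ)) =
      ∏ i, Complex.exp (Complex.I * (η i * z i)) := by
    intro z
    rw [← Complex.exp_sum, ← Finset.mul_sum]
    push_cast
    rfl
  simp only [h]
  rw [integral_fintype_prod_eq_prod (fun i (x : ℝ) => Complex.exp (Complex.I * (η i * x)))]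
  simp only [integral_cexp_stdGauss]
  rw [← Complex.exp_sum, Complex.ofReal_exp]
  congr 1
  push_cast
  rw [← Finset.sum_div, Finset.sum_neg_distrib]

lemma integral_mul_cexp_pi_stdGauss {n : ℕ} (η : Fin n → ℝ) (j : Fin n) :
    ∫ z : Fin n → ℝ, (z j : ℂ) * Complex.exp (Complex.I * ((∑ i, η i * z i : ℝ) : ℂ))
      ∂(Measure.pi fun _ => stdGauss) =
      Complex.I * η j * (Real.exp (-(∑ i, η i ^ 2) / 2) : ℂ) := by
  have h : ∀ z : Fin n → ℝ, (z j : ℂ) * Complex.exp (Complex.I * ((∑ i, η i * z i : ℝ) : ℂ)) =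
      ∏ i, (if i = j then (z i : ℂ) else 1) * Complex.exp (Complex.I * (η i * z i)) := by
    intro z
    rw [Finset.prod_mul_distrib, ← Complex.exp_sum, ← Finset.mul_sum]
    simp
  simp only [h]
  rw [integral_fintype_prod_eq_prod (fun i (x : ℝ) =>
    (if i = j then (x : ℂ) else 1) * Complex.exp (Complex.I * (η i * x)))]
  have h2 : ∀ i, ∫ x : ℝ, (if i = j then (x : ℂ) else 1) * Complex.exp (Complex.I * (η i * x))
      ∂stdGauss = (if i = j then Complex.I * η i else 1) * Complex.exp (-η i ^ 2 / 2) := by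
    intro i
    split_ifs
    · exact integral_mul_cexp_stdGauss _
    · simpa using integral_cexp_stdGauss _
  simp only [h2]
  rw [Finset.prod_mul_distrib, ← Complex.exp_sum, Complex.ofReal_exp]
  simp only [Finset.prod_ite_eq', Finset.mem_univ, if_true]
  congr 2
  push_cast
  rw [← Finset.sum_div, Finset.sum_neg_distrib]

/-- An integrable function of a Gaussian pair. -/
structure Weight (n : ℕ) where
  /-- The function. -/
  toFun : (Fin n → ℝ) × ℝ → ℝ
  integrable : Integrable toFun (gaussPair n)

/-- The mass of the absolute value of a weight. -/
def Weight.mass {n : ℕ} (w : Weight n) : ℝ := ∫ p, |w.toFun p| ∂gaussPair n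

lemma Weight.mass_nonneg {n : ℕ} (w : Weight n) : 0 ≤ w.mass :=
  integral_nonneg fun _ => abs_nonneg _

/-- The Fourier transform of the image of the weighted Gaussian measure under the quotient map. -/
def Weight.symb {n : ℕ} (w : Weight n) (ξ : Fin n → ℝ) : ℂ :=
  ∫ p, (w.toFun p : ℂ) * Complex.exp (Complex.I * ((∑ i, ξ i * (p.1 i / p.2) : ℝ) : ℂ))
    ∂gaussPair n

/-- Moments of order `1/2` of the weighted quotient exist. -/
def Weight.HasRootMoment {n : ℕ} (w : Weight n) : Prop :=
  ∀ i, Integrable (fun p => w.toFun p * √|p.1 i / p.2|) (gaussPair n)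

variable {n : ℕ}

lemma measurable_quot (i : Fin n) : Measurable fun p : (Fin n → ℝ) × ℝ => p.1 i / p.2 :=
  ((measurable_pi_apply i).comp measurable_fst).div measurable_snd

lemma measurable_phase (ξ : Fin n → ℝ) : Measurable fun p : (Fin n → ℝ) × ℝ =>
    Complex.exp (Complex.I * ((∑ i, ξ i * (p.1 i / p.2) : ℝ) : ℂ)) := by
  have : Measurable fun p : (Fin n → ℝ) × ℝ => ∑ i, ξ i * (p.1 i / p.2) :=
    Finset.measurable_sum _ fun i _ => (measurable_quot i).const_mul _
  exact Complex.measurable_exp.comp ((Complex.measurable_ofReal.comp this).const_mul _)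

lemma norm_cexp_I_mul (x : ℝ) : ‖Complex.exp (Complex.I * x)‖ = 1 := by
  rw [mul_comm, Complex.norm_exp_ofReal_mul_I]

lemma Weight.integrable_symb (w : Weight n) (ξ : Fin n → ℝ) :
    Integrable (fun p => (w.toFun p : ℂ) *
      Complex.exp (Complex.I * ((∑ i, ξ i * (p.1 i / p.2) : ℝ) : ℂ))) (gaussPair n) :=
  w.integrable.ofReal.mul_bdd (c := 1) (measurable_phase ξ).aestronglyMeasurable
    (ae_of_all _ fun _ => (norm_cexp_I_mul _).le)

lemma sum_phase_eq (ξ z : Fin n → ℝ) (y : ℝ) :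
    ∑ i, ξ i * (z i / y) = ∑ i, (ξ i / y) * z i :=
  Finset.sum_congr rfl fun i _ => by ring

lemma sum_div_sq_eq (ξ : Fin n → ℝ) (y : ℝ) :
    ∑ i, (ξ i / y) ^ 2 = (√(∑ i, ξ i ^ 2) / y) ^ 2 := by
  rw [div_pow, Real.sq_sqrt (Finset.sum_nonneg fun i _ => sq_nonneg _), Finset.sum_div]
  simp only [div_pow]

lemma integral_phase_snd (a : ℝ → ℝ) (ξ : Fin n → ℝ)
    (h : Integrable (fun p => ((a p.2 : ℝ) : ℂ) *
      Complex.exp (Complex.I * ((∑ i, ξ i * (p.1 i / p.2) : ℝ) : ℂ))) (gaussPair n)) :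
    ∫ p, ((a p.2 : ℝ) : ℂ) *
      Complex.exp (Complex.I * ((∑ i, ξ i * (p.1 i / p.2) : ℝ) : ℂ)) ∂gaussPair n =
      ((∫ y, a y * Real.exp (-(√(∑ i, ξ i ^ 2) / y) ^ 2 / 2) ∂stdGauss : ℝ) : ℂ) := by
  rw [integral_prod_symm _ h, ← integral_complex_ofReal]
  refine integral_congr_ae (ae_of_all _ fun y => ?_)
  simp only [sum_phase_eq]
  rw [integral_const_mul, integral_cexp_pi_stdGauss, sum_div_sq_eq]
  push_cast
  rfl

/-- The weight that produces the Poisson semigroup. -/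
def poissonWeight (n : ℕ) : Weight n := ⟨fun _ => 1, integrable_const 1⟩

/-- The weight that produces the time derivative of the Poisson semigroup. -/
def timeWeight (n : ℕ) : Weight n :=
  ⟨fun p => p.2 ^ 2 - 1, (integrable_sq_stdGauss.comp_snd _).sub (integrable_const 1)⟩

lemma integrable_id_stdGauss : Integrable (fun x : ℝ => x) stdGauss :=
  (memLp_id_gaussianReal' (μ := 0) (v := 1) 1 (by simp)).integrable le_rfl

/-- The weight that produces the `j`-th space derivative of the Poisson semigroup. -/
def spaceWeight (j : Fin n) : Weight n :=
  ⟨fun p => p.1 j * p.2,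
    (integrable_comp_eval (μ := fun _ : Fin n => stdGauss) (i := j)
      integrable_id_stdGauss).mul_prod integrable_id_stdGauss⟩

lemma symb_poissonWeight (ξ : Fin n → ℝ) :
    (poissonWeight n).symb ξ = (Real.exp (-√(∑ i, ξ i ^ 2)) : ℂ) := by
  have h := integral_phase_snd (fun _ => 1) ξ ((poissonWeight n).integrable_symb ξ)
  simp only [one_mul, integral_exp_stdGauss (Real.sqrt_nonneg _)] at h
  exact h

lemma symb_timeWeight (ξ : Fin n → ℝ) :
    (timeWeight n).symb ξ =
      ((√(∑ i, ξ i ^ 2) * Real.exp (-√(∑ i, ξ i ^ 2)) : ℝ) : ℂ) := by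
  have h := integral_phase_snd (fun y => y ^ 2 - 1) ξ ((timeWeight n).integrable_symb ξ)
  rw [integral_sq_sub_one_mul_exp_stdGauss (Real.sqrt_nonneg _)] at h
  exact h

lemma symb_spaceWeight (j : Fin n) (ξ : Fin n → ℝ) :
    (spaceWeight j).symb ξ = Complex.I * ξ j * (Real.exp (-√(∑ i, ξ i ^ 2)) : ℂ) := by
  have h := (spaceWeight j).integrable_symb ξ
  rw [Weight.symb, integral_prod_symm _ h,
    ← integral_exp_stdGauss (Real.sqrt_nonneg (∑ i, ξ i ^ 2)), ← integral_complex_ofReal,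
    ← integral_const_mul]
  refine integral_congr_ae ?_
  filter_upwards [ae_ne_zero_stdGauss] with y hy
  simp only [sum_phase_eq, spaceWeight]
  have h1 : ∀ z : Fin n → ℝ, ((z j * y : ℝ) : ℂ) *
      Complex.exp (Complex.I * ((∑ i, (ξ i / y) * z i : ℝ) : ℂ)) =
      (y : ℂ) * ((z j : ℂ) * Complex.exp (Complex.I * ((∑ i, (ξ i / y) * z i : ℝ) : ℂ))) := by
    intro z
    push_cast
    ring
  simp only [h1]
  rw [integral_const_mul, integral_mul_cexp_pi_stdGauss, sum_div_sq_eq]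
  have hy' : (y : ℂ) ≠ 0 := by exact_mod_cast hy
  push_cast
  field_simp

lemma symb_timeWeight_zero : (timeWeight n).symb 0 = 0 := by
  simp [symb_timeWeight]

lemma symb_spaceWeight_zero (j : Fin n) : (spaceWeight j).symb 0 = 0 := by
  simp [symb_spaceWeight]

lemma Weight.integral_eq_zero {w : Weight n} (h : w.symb 0 = 0) :
    ∫ p, w.toFun p ∂gaussPair n = 0 := by
  simp only [Weight.symb, Pi.zero_apply, zero_mul, Finset.sum_const_zero, Complex.ofReal_zero,
    mul_zero, Complex.exp_zero, mul_one] at h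
  rw [integral_complex_ofReal] at h
  exact_mod_cast h

lemma integrable_inv_sqrt_abs_stdGauss : Integrable (fun y : ℝ => (√|y|)⁻¹) stdGauss := by
  rw [integrable_stdGauss_iff]
  have h := integrable_rpow_mul_exp_neg_mul_sq (b := 1 / 2) (by norm_num) (s := -(1 / 2))
    (by norm_num)
  refine Integrable.mono' ((h.norm.add h.norm.comp_neg).const_mul (√(2 * Real.pi))⁻¹)
    (continuous_stdPdf.measurable.mul (by fun_prop)).aestronglyMeasurable (ae_of_all _ fun y => ?_)
  have key : ∀ x : ℝ, 0 ≤ x →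
      x ^ (-(1 / 2) : ℝ) * Real.exp (-(1 / 2) * x ^ 2) = Real.exp (-x ^ 2 / 2) * (√x)⁻¹ := by
    intro x hx
    rw [Real.rpow_neg hx, ← Real.sqrt_eq_rpow, mul_comm]
    congr 2
    ring
  have hp : 0 ≤ Real.exp (-y ^ 2 / 2) * (√|y|)⁻¹ := by positivity
  rw [norm_mul, stdPdf_eq, norm_mul, Real.norm_of_nonneg (Real.exp_nonneg _),
    Real.norm_of_nonneg (by positivity : 0 ≤ (√(2 * Real.pi))⁻¹),
    Real.norm_of_nonneg (by positivity : 0 ≤ (√|y|)⁻¹), mul_assoc]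
  refine mul_le_mul_of_nonneg_left ?_ (by positivity)
  simp only [Pi.add_apply]
  rcases le_total 0 y with hy | hy
  · rw [abs_of_nonneg hy, key y hy]
    exact (le_abs_self _).trans (le_add_of_nonneg_right (norm_nonneg _))
  · rw [abs_of_nonpos hy, key (-y) (by linarith), neg_sq]
    exact (le_abs_self _).trans (le_add_of_nonneg_left (norm_nonneg _))

lemma integrable_stdGauss_of_le {f : ℝ → ℝ} (hf : Measurable f)
    (h : ∀ y, |f y| ≤ y ^ 2 + 1 + (√|y|)⁻¹) : Integrable f stdGauss :=
  ((integrable_sq_stdGauss.add (integrable_const 1)).add integrable_inv_sqrt_abs_stdGauss).mono'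
    hf.aestronglyMeasurable (ae_of_all _ h)

lemma integrable_sqrt_abs_stdGauss : Integrable (fun y : ℝ => √|y|) stdGauss := by
  refine integrable_stdGauss_of_le (by fun_prop) fun y => ?_
  rw [abs_of_nonneg (Real.sqrt_nonneg _)]
  have h1 := Real.sq_sqrt (abs_nonneg y)
  have h2 := sq_abs y
  have h3 : 0 ≤ (√|y|)⁻¹ := by positivity
  nlinarith [sq_nonneg (√|y| - 1), sq_nonneg (|y| - 1)]

lemma hasRootMoment_mul {w : Weight n} {a : (Fin n → ℝ) → ℝ} {b : ℝ → ℝ}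
    (hw : ∀ p, w.toFun p = a p.1 * b p.2)
    (ha : ∀ i, Integrable (fun z => a z * √|z i|) (Measure.pi fun _ => stdGauss))
    (hb : Integrable (fun y => b y * (√|y|)⁻¹) stdGauss) : w.HasRootMoment := by
  intro i
  refine ((ha i).mul_prod hb).congr (ae_of_all _ fun p => ?_)
  simp only [hw, abs_div, Real.sqrt_div (abs_nonneg _)]
  ring

lemma hasRootMoment_timeWeight : (timeWeight n).HasRootMoment := by
  refine hasRootMoment_mul (a := fun _ => 1) (b := fun y => y ^ 2 - 1)
    (fun p => by simp [timeWeight]) (fun i => ?_) ?_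
  · simp only [one_mul]
    exact integrable_comp_eval (μ := fun _ : Fin n => stdGauss) (i := i)
      integrable_sqrt_abs_stdGauss
  · refine integrable_stdGauss_of_le (by fun_prop) fun y => ?_
    rcases eq_or_ne y 0 with rfl | hy
    · simp
    have hs : 0 < √|y| := Real.sqrt_pos.2 (abs_pos.2 hy)
    have h1 := Real.sq_sqrt (abs_nonneg y)
    have h2 := sq_abs y
    rw [abs_mul, abs_of_pos (inv_pos.2 hs)]
    have h3 : |y ^ 2 - 1| ≤ y ^ 2 + 1 := abs_le.2 ⟨by nlinarith, by nlinarith⟩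
    have h4 : y ^ 2 * (√|y|)⁻¹ ≤ y ^ 2 + 1 := by
      have h6 : y ^ 2 = √|y| ^ 4 := by
        linear_combination -h2 - (|y| + √|y| ^ 2) * h1
      rw [mul_inv_le_iff₀ hs, h6]
      rcases le_total (√|y|) 1 with h | h
      · nlinarith [pow_le_one₀ (n := 3) hs.le h, pow_pos hs 5]
      · nlinarith [pow_pos hs 4]
    calc |y ^ 2 - 1| * (√|y|)⁻¹ ≤ (y ^ 2 + 1) * (√|y|)⁻¹ := by gcongr
      _ = y ^ 2 * (√|y|)⁻¹ + (√|y|)⁻¹ := by ring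
      _ ≤ _ := by linarith

lemma hasRootMoment_spaceWeight (j : Fin n) : (spaceWeight j).HasRootMoment := by
  refine hasRootMoment_mul (a := fun z => z j) (b := fun y => y)
    (fun p => by simp [spaceWeight]) (fun i => ?_) ?_
  · have h1 : Integrable (fun z : Fin n → ℝ => z j ^ 2) (Measure.pi fun _ => stdGauss) :=
      integrable_comp_eval (μ := fun _ : Fin n => stdGauss) (i := j) integrable_sq_stdGauss
    have h2 : Integrable (fun z : Fin n → ℝ => |z i|) (Measure.pi fun _ => stdGauss) :=
      integrable_comp_eval (μ := fun _ : Fin n => stdGauss) (i := i) integrable_id_stdGauss.abs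
    refine (h1.add h2).mono' (by fun_prop) (ae_of_all _ fun z => ?_)
    rw [norm_mul, Real.norm_eq_abs, Real.norm_of_nonneg (Real.sqrt_nonneg _), Pi.add_apply,
      ← sq_abs]
    nlinarith [Real.sq_sqrt (abs_nonneg (z i)), sq_nonneg (|z j| - √|z i|)]
  · refine integrable_stdGauss_of_le (by fun_prop) fun y => ?_
    rcases eq_or_ne y 0 with rfl | hy
    · simp
    have hs : 0 < √|y| := Real.sqrt_pos.2 (abs_pos.2 hy)
    have h1 := Real.sq_sqrt (abs_nonneg y)
    have h2 := sq_abs y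
    rw [abs_mul, abs_of_pos (inv_pos.2 hs)]
    have h5 : |y| * (√|y|)⁻¹ = √|y| := by
      rw [mul_inv_eq_iff_eq_mul₀ hs.ne']
      nlinarith
    have h3 : 0 ≤ (√|y|)⁻¹ := by positivity
    rw [h5]
    nlinarith [sq_nonneg (√|y| - 1), sq_nonneg (|y| - 1)]

end Weights

/-- The phase `2π k·y`. -/
def phase {n : ℕ} (k : Fin n → ℤ) (y : Fin n → ℝ) : ℝ := ∑ i, 2 * Real.pi * k i * y i

/-- A strongly continuous action of `ℝⁿ` on a normed space by contractions, with a separating family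
of functionals which behave under the action like Fourier coefficients. -/
structure TorusRep (n : ℕ) (E : Type*) [NormedAddCommGroup E] [NormedSpace ℝ E] where
  /-- The action. -/
  shift : (Fin n → ℝ) → E →L[ℝ] E
  /-- The Fourier coefficients. -/
  coeff : (Fin n → ℤ) → E →L[ℝ] ℂ
  norm_shift_le : ∀ y u, ‖shift y u‖ ≤ ‖u‖
  continuous_shift : ∀ u, Continuous fun y => shift y u
  coeff_shift : ∀ k y u, coeff k (shift y u) = Complex.exp (Complex.I * phase k y) * coeff k u
  eq_zero_of_coeff : ∀ u, (∀ k, coeff k u = 0) → u = 0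

namespace TorusRep

variable {n : ℕ} {E : Type*} [NormedAddCommGroup E] [NormedSpace ℝ E]
  (T : TorusRep n E)

lemma ext_coeff {u v : E} (h : ∀ k, T.coeff k u = T.coeff k v) : u = v :=
  sub_eq_zero.1 <| T.eq_zero_of_coeff _ fun k => by rw [map_sub, h, sub_self]

lemma phase_zero (k : Fin n → ℤ) : phase k 0 = 0 := by simp [phase]

lemma phase_add (k : Fin n → ℤ) (y z : Fin n → ℝ) : phase k (y + z) = phase k y + phase k z := by
  simp [phase, mul_add, Finset.sum_add_distrib]

lemma phase_smul (k : Fin n → ℤ) (c : ℝ) (y : Fin n → ℝ) : phase k (c • y) = c * phase k y := by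
  simp only [phase, Pi.smul_apply, smul_eq_mul, Finset.mul_sum]
  exact Finset.sum_congr rfl fun i _ => by ring

lemma phase_single (k : Fin n → ℤ) (j : Fin n) (h : ℝ) :
    phase k (Pi.single j h) = 2 * Real.pi * k j * h := by
  simp [phase, Pi.single_apply]

lemma shift_zero (u : E) : T.shift 0 u = u :=
  T.ext_coeff fun k => by rw [coeff_shift, phase_zero]; simp

lemma shift_add (y z : Fin n → ℝ) (u : E) : T.shift (y + z) u = T.shift y (T.shift z u) :=
  T.ext_coeff fun k => by
    simp only [coeff_shift, phase_add]
    rw [← mul_assoc, ← Complex.exp_add]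
    push_cast
    ring_nf

lemma norm_shift_sub_le (y : Fin n → ℝ) (u : E) : ‖T.shift y u - u‖ ≤ 2 * ‖u‖ :=
  (norm_sub_le _ _).trans (by linarith [T.norm_shift_le y u])

/-- A modulus of continuity in the coordinate directions controls all translations. -/
lemma norm_shift_sub_le_sum {f : E} {H : ℝ}
    (hf : ∀ i h, ‖T.shift (Pi.single i h) f - f‖ ≤ H * √|h|) (y : Fin n → ℝ) :
    ‖T.shift y f - f‖ ≤ ∑ i, H * √|y i| := by
  have key : ∀ s : Finset (Fin n), ‖T.shift (∑ i ∈ s, Pi.single i (y i)) f - f‖ ≤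
      ∑ i ∈ s, H * √|y i| := by
    intro s
    induction s using Finset.induction_on with
    | empty => simp [T.shift_zero]
    | insert a s ha ih =>
      rw [Finset.sum_insert ha, Finset.sum_insert ha, add_comm (Pi.single a _), T.shift_add]
      calc ‖T.shift (∑ i ∈ s, Pi.single i (y i)) (T.shift (Pi.single a (y a)) f) - f‖
          = ‖T.shift (∑ i ∈ s, Pi.single i (y i)) (T.shift (Pi.single a (y a)) f - f) +
            (T.shift (∑ i ∈ s, Pi.single i (y i)) f - f)‖ := by
              rw [map_sub]
              congr 1
              abel
        _ ≤ ‖T.shift (Pi.single a (y a)) f - f‖ +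
            ‖T.shift (∑ i ∈ s, Pi.single i (y i)) f - f‖ :=
              (norm_add_le _ _).trans (add_le_add_left (T.norm_shift_le _ _) _)
        _ ≤ _ := add_le_add (hf a (y a)) ih
  simpa [Finset.univ_sum_single] using key Finset.univ

/-- The displacement `r z / y`. -/
def disp (r : ℝ) (p : (Fin n → ℝ) × ℝ) : Fin n → ℝ := fun i => r * (p.1 i / p.2)

lemma measurable_disp (r : ℝ) : Measurable (disp (n := n) r) :=
  measurable_pi_lambda _ fun i => (measurable_quot i).const_mul r

lemma continuous_disp (p : (Fin n → ℝ) × ℝ) : Continuous fun r => disp r p :=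
  continuous_pi fun _ => continuous_id.mul continuous_const

lemma stronglyMeasurable_shift_disp (r : ℝ) (u : E) :
    StronglyMeasurable fun p : (Fin n → ℝ) × ℝ => T.shift (disp r p) u :=
  (T.continuous_shift u).stronglyMeasurable.comp_measurable (measurable_disp r)

lemma integrable_avg (w : Weight n) (r : ℝ) (u : E) :
    Integrable (fun p => w.toFun p • T.shift (disp r p) u) (gaussPair n) := by
  refine (w.integrable.abs.mul_const ‖u‖).mono'
    (w.integrable.aestronglyMeasurable.smul
      (T.stronglyMeasurable_shift_disp r u).aestronglyMeasurable) (ae_of_all _ fun p => ?_)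
  rw [norm_smul, Real.norm_eq_abs]
  exact mul_le_mul_of_nonneg_left (T.norm_shift_le _ _) (abs_nonneg _)

lemma norm_integral_avg_le (w : Weight n) (r : ℝ) (u : E) :
    ‖∫ p, w.toFun p • T.shift (disp r p) u ∂gaussPair n‖ ≤ w.mass * ‖u‖ := by
  rw [Weight.mass, ← integral_mul_const]
  refine norm_integral_le_of_norm_le (w.integrable.abs.mul_const ‖u‖) (ae_of_all _ fun p => ?_)
  rw [norm_smul, Real.norm_eq_abs]
  exact mul_le_mul_of_nonneg_left (T.norm_shift_le _ _) (abs_nonneg _)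

/-- The weighted average of the translations by the displacements `r z / y`. -/
def avg (w : Weight n) (r : ℝ) : E →L[ℝ] E :=
  LinearMap.mkContinuous
    { toFun := fun u => ∫ p, w.toFun p • T.shift (disp r p) u ∂gaussPair n
      map_add' := fun u v => by
        simp only [map_add, smul_add]
        exact integral_add (T.integrable_avg w r u) (T.integrable_avg w r v)
      map_smul' := fun c u => by
        simp only [map_smul, RingHom.id_apply]
        rw [← integral_smul]
        exact integral_congr_ae (ae_of_all _ fun p => smul_comm _ _ _) }
    w.mass fun u => T.norm_integral_avg_le w r u

lemma avg_apply (w : Weight n) (r : ℝ) (u : E) :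
    T.avg w r u = ∫ p, w.toFun p • T.shift (disp r p) u ∂gaussPair n := rfl

lemma norm_avg_le (w : Weight n) (r : ℝ) (u : E) : ‖T.avg w r u‖ ≤ w.mass * ‖u‖ :=
  T.norm_integral_avg_le w r u

lemma continuous_avg (w : Weight n) (u : E) : Continuous fun r => T.avg w r u := by
  simp only [avg_apply]
  refine continuous_of_dominated (bound := fun p => |w.toFun p| * ‖u‖)
    (fun r => (T.integrable_avg w r u).aestronglyMeasurable) (fun r => ae_of_all _ fun p => ?_)
    (w.integrable.abs.mul_const ‖u‖) (ae_of_all _ fun p => ?_)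
  · rw [norm_smul, Real.norm_eq_abs]
    exact mul_le_mul_of_nonneg_left (T.norm_shift_le _ _) (abs_nonneg _)
  · exact ((T.continuous_shift u).comp (continuous_disp p)).const_smul _

lemma continuous_avg_uncurry (w : Weight n) : Continuous fun q : ℝ × E => T.avg w q.1 q.2 := by
  refine continuous_prod_of_continuous_lipschitzWith' (fun q : ℝ × E => T.avg w q.1 q.2)
    w.mass.toNNReal (fun r => ?_) fun u => T.continuous_avg w u
  refine LipschitzWith.of_dist_le_mul fun u v => ?_
  rw [dist_eq_norm, dist_eq_norm, ← map_sub, Real.coe_toNNReal _ w.mass_nonneg]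
  exact T.norm_avg_le w r _

lemma norm_avg_le_sqrt [CompleteSpace E] {w : Weight n} (h0 : w.symb 0 = 0) (hw : w.HasRootMoment) :
    ∃ C, 0 ≤ C ∧ ∀ (f : E) (H : ℝ), (∀ i h, ‖T.shift (Pi.single i h) f - f‖ ≤ H * √|h|) →
      ∀ r, 0 ≤ r → ‖T.avg w r f‖ ≤ C * H * √r := by
  refine ⟨∑ i, ∫ p, |w.toFun p| * √|p.1 i / p.2| ∂gaussPair n,
    Finset.sum_nonneg fun i _ => integral_nonneg fun p => by positivity, fun f H hf r hr => ?_⟩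
  have h1 : T.avg w r f = ∫ p, w.toFun p • (T.shift (disp r p) f - f) ∂gaussPair n := by
    simp only [smul_sub]
    rw [integral_sub (T.integrable_avg w r f) (w.integrable.smul_const f), integral_smul_const,
      w.integral_eq_zero h0, zero_smul, sub_zero, avg_apply]
  rw [h1, Finset.sum_mul, Finset.sum_mul]
  have h2 : ∀ i, Integrable (fun p => |w.toFun p| * √|p.1 i / p.2| * (H * √r)) (gaussPair n) := by
    intro i
    have := (hw i).abs
    simp only [abs_mul, abs_of_nonneg (Real.sqrt_nonneg _)] at this
    exact this.mul_const _
  have h3 : ∑ i, (∫ p, |w.toFun p| * √|p.1 i / p.2| ∂gaussPair n) * H * √r =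
      ∫ p, ∑ i, |w.toFun p| * √|p.1 i / p.2| * (H * √r) ∂gaussPair n := by
    rw [integral_finsetSum _ fun i _ => h2 i]
    exact Finset.sum_congr rfl fun i _ => by rw [integral_mul_const, mul_assoc]
  rw [h3]
  refine norm_integral_le_of_norm_le (integrable_finsetSum _ fun i _ => h2 i)
    (ae_of_all _ fun p => ?_)
  rw [norm_smul, Real.norm_eq_abs]
  refine (mul_le_mul_of_nonneg_left (T.norm_shift_sub_le_sum hf _) (abs_nonneg _)).trans
    (le_of_eq ?_)
  rw [Finset.mul_sum]
  refine Finset.sum_congr rfl fun i _ => ?_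
  simp only [disp, abs_mul, abs_of_nonneg hr, Real.sqrt_mul hr]
  ring

/-- The Poisson semigroup, extended to negative times by symmetry. -/
def poisson (r : ℝ) : E →L[ℝ] E := T.avg (poissonWeight n) r

lemma norm_poisson_le (r : ℝ) (u : E) : ‖T.poisson r u‖ ≤ ‖u‖ := by
  have h : (poissonWeight n).mass = 1 := by simp [Weight.mass, poissonWeight]
  simpa [h, poisson] using T.norm_avg_le (poissonWeight n) r u

lemma continuous_poisson : Continuous fun q : ℝ × E => T.poisson q.1 q.2 :=
  T.continuous_avg_uncurry _

lemma continuous_shift_smul (y : Fin n → ℝ) (v : E) :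
    Continuous fun s : ℝ => T.shift (s • y) v :=
  (T.continuous_shift v).comp (continuous_id.smul continuous_const)

variable [CompleteSpace E]

lemma coeff_avg (w : Weight n) (r : ℝ) (u : E) (k : Fin n → ℤ) :
    T.coeff k (T.avg w r u) = w.symb (fun i => 2 * Real.pi * r * k i) * T.coeff k u := by
  rw [avg_apply, ← ContinuousLinearMap.integral_comp_comm _ (T.integrable_avg w r u),
    Weight.symb, ← integral_mul_const]
  refine integral_congr_ae (ae_of_all _ fun p => ?_)
  have h : phase k (disp r p) = ∑ i, 2 * Real.pi * r * k i * (p.1 i / p.2) :=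
    Finset.sum_congr rfl fun i _ => by simp only [disp]; ring
  simp only [map_smul, coeff_shift, Complex.real_smul, mul_assoc, h]

lemma sqrt_sum_eq_halfLaplaceSymbol (k : Fin n → ℤ) {r : ℝ} (hr : 0 ≤ r) :
    √(∑ i, (2 * Real.pi * r * k i) ^ 2) = halfLaplaceSymbol k * r := by
  have h : ∀ i, (2 * Real.pi * r * k i) ^ 2 = (2 * Real.pi * r) ^ 2 * (k i : ℝ) ^ 2 :=
    fun i => mul_pow _ _ _
  simp only [h]
  rw [← Finset.mul_sum, Real.sqrt_mul (sq_nonneg _), Real.sqrt_sq (by positivity),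
    halfLaplaceSymbol]
  ring

lemma coeff_poisson {r : ℝ} (hr : 0 ≤ r) (u : E) (k : Fin n → ℤ) :
    T.coeff k (T.poisson r u) = (Real.exp (-(halfLaplaceSymbol k * r)) : ℂ) * T.coeff k u := by
  rw [poisson, coeff_avg, symb_poissonWeight, sqrt_sum_eq_halfLaplaceSymbol k hr]

lemma poisson_zero (u : E) : T.poisson 0 u = u :=
  T.ext_coeff fun k => by simp [T.coeff_poisson le_rfl]

lemma poisson_add {r s : ℝ} (hr : 0 ≤ r) (hs : 0 ≤ s) (u : E) :
    T.poisson (r + s) u = T.poisson r (T.poisson s u) :=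
  T.ext_coeff fun k => by
    rw [T.coeff_poisson (add_nonneg hr hs), T.coeff_poisson hr, T.coeff_poisson hs, ← mul_assoc]
    congr 1
    rw [← Complex.ofReal_mul, ← Real.exp_add]
    ring_nf

end TorusRep

/-- The operators `r⁻¹ avg w r` have the Fourier multiplier `m k exp(-|2πk|r)`. -/
def Weight.Generates {n : ℕ} (w : Weight n) (m : (Fin n → ℤ) → ℂ) : Prop :=
  ∀ r, 0 ≤ r → ∀ k, w.symb (fun i => 2 * Real.pi * r * k i) =
    r * m k * (Real.exp (-(halfLaplaceSymbol k * r)) : ℂ)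

lemma generates_timeWeight (n : ℕ) :
    (timeWeight n).Generates fun k => (halfLaplaceSymbol k : ℂ) := by
  intro r hr k
  rw [symb_timeWeight, TorusRep.sqrt_sum_eq_halfLaplaceSymbol k hr]
  push_cast
  ring

/-- The Fourier multiplier of the `j`-th partial derivative. -/
def partialSymbol {n : ℕ} (j : Fin n) (k : Fin n → ℤ) : ℂ := Complex.I * (2 * Real.pi * k j : ℝ)

lemma generates_spaceWeight {n : ℕ} (j : Fin n) :
    (spaceWeight j).Generates (partialSymbol j) := by
  intro r hr k
  rw [symb_spaceWeight, TorusRep.sqrt_sum_eq_halfLaplaceSymbol k hr, partialSymbol]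
  push_cast
  ring

namespace TorusRep

variable {n : ℕ} {E : Type*} [NormedAddCommGroup E] [NormedSpace ℝ E] [CompleteSpace E]
  (T : TorusRep n E)

lemma coeff_inv_smul_avg {w : Weight n} {m : (Fin n → ℤ) → ℂ} (hw : w.Generates m) {r : ℝ}
    (hr : 0 < r) (u : E) (k : Fin n → ℤ) :
    T.coeff k (r⁻¹ • T.avg w r u) = m k * T.coeff k (T.poisson r u) := by
  have : (r : ℂ) ≠ 0 := by exact_mod_cast hr.ne'
  rw [map_smul, coeff_avg, hw r hr.le, T.coeff_poisson hr.le, Complex.real_smul]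
  push_cast
  field_simp

/-- The fundamental theorem of calculus for translations. -/
lemma shift_sub_eq_integral {u v : E} (y : Fin n → ℝ)
    (h : ∀ k, T.coeff k v = Complex.I * phase k y * T.coeff k u) :
    T.shift y u - u = ∫ s in (0 : ℝ)..1, T.shift (s • y) v := by
  refine T.ext_coeff fun k => ?_
  rw [← ContinuousLinearMap.intervalIntegral_comp_comm _
    ((T.continuous_shift_smul y v).intervalIntegrable _ _)]
  simp only [coeff_shift, phase_smul, map_sub, h]
  have hd : ∀ s : ℝ, HasDerivAt
      (fun s : ℝ => Complex.exp (Complex.I * ((s * phase k y : ℝ) : ℂ)) * T.coeff k u)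
      (Complex.exp (Complex.I * ((s * phase k y : ℝ) : ℂ)) *
        (Complex.I * phase k y * T.coeff k u)) s := by
    intro s
    have h1 : HasDerivAt (fun s : ℝ => Complex.I * ((s * phase k y : ℝ) : ℂ))
        (Complex.I * ((1 * phase k y : ℝ) : ℂ)) s :=
      (((hasDerivAt_id s).mul_const (phase k y)).ofReal_comp).const_mul _
    refine (h1.cexp.mul_const _).congr_deriv ?_
    rw [one_mul]
    ring
  rw [intervalIntegral.integral_eq_sub_of_hasDerivAt (fun s _ => hd s)
    (Continuous.intervalIntegrable (by fun_prop) _ _)]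
  simp

lemma norm_shift_sub_le_of_coeff {u v : E} (y : Fin n → ℝ)
    (h : ∀ k, T.coeff k v = Complex.I * phase k y * T.coeff k u) :
    ‖T.shift y u - u‖ ≤ ‖v‖ := by
  rw [T.shift_sub_eq_integral y h]
  have := intervalIntegral.norm_integral_le_of_norm_le_const (a := 0) (b := 1)
    (f := fun s : ℝ => T.shift (s • y) v) (C := ‖v‖) fun s _ => T.norm_shift_le _ _
  simpa using this

/-- The Poisson semigroup maps bounded sets to sets which are equi-Hölder continuous of
exponent `1/2`. -/
lemma norm_shift_poisson_sub_le :
    ∃ C, 0 ≤ C ∧ ∀ (u : E) (j : Fin n) (h r : ℝ), 0 < r →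
      ‖T.shift (Pi.single j h) (T.poisson r u) - T.poisson r u‖ ≤ C * ‖u‖ * √|h| / √r := by
  set D := ∑ j : Fin n, (spaceWeight j).mass with hD
  have hD0 : 0 ≤ D := Finset.sum_nonneg fun j _ => Weight.mass_nonneg _
  refine ⟨2 + D, by linarith, fun u j h r hr => ?_⟩
  have hu := norm_nonneg u
  have hDj : (spaceWeight j).mass ≤ D :=
    Finset.single_le_sum (f := fun j : Fin n => (spaceWeight j).mass)
      (fun j _ => Weight.mass_nonneg _) (Finset.mem_univ j)
  have h1 : ‖T.shift (Pi.single j h) (T.poisson r u) - T.poisson r u‖ ≤ 2 * ‖u‖ :=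
    (T.norm_shift_sub_le _ _).trans (by linarith [T.norm_poisson_le r u])
  have h2 : ‖T.shift (Pi.single j h) (T.poisson r u) - T.poisson r u‖ ≤
      |h| / r * (D * ‖u‖) := by
    refine (T.norm_shift_sub_le_of_coeff (v := h • r⁻¹ • T.avg (spaceWeight j) r u) _
      fun k => ?_).trans ?_
    · rw [map_smul, T.coeff_inv_smul_avg (generates_spaceWeight j) hr, phase_single,
        Complex.real_smul, partialSymbol]
      push_cast
      ring
    · rw [norm_smul, norm_smul, Real.norm_eq_abs, norm_inv, Real.norm_of_nonneg hr.le,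
        div_eq_mul_inv, mul_assoc]
      have := (T.norm_avg_le (spaceWeight j) r u).trans (mul_le_mul_of_nonneg_right hDj hu)
      gcongr
  rw [mul_div_assoc, ← Real.sqrt_div (abs_nonneg _)]
  have hx : 0 ≤ |h| / r := by positivity
  generalize |h| / r = x at *
  have hs := Real.sq_sqrt hx
  have hs0 := Real.sqrt_nonneg x
  have hDu : 0 ≤ D * ‖u‖ := by positivity
  rcases le_total (√x) 1 with hx1 | hx1
  · refine h2.trans ?_
    have : x * (D * ‖u‖) ≤ √x * (D * ‖u‖) := mul_le_mul_of_nonneg_right (by nlinarith) hDu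
    nlinarith [mul_nonneg hu hs0]
  · refine h1.trans ?_
    have : ‖u‖ * 1 ≤ ‖u‖ * √x := mul_le_mul_of_nonneg_left hx1 hu
    nlinarith [mul_nonneg hDu hs0]

end TorusRep

section Convolution

variable {E : Type*} [NormedAddCommGroup E]

lemma exists_bound_of_continuousOn {f : ℝ → E} {a : ℝ} (hf : ContinuousOn f (Ici a)) (R : ℝ) :
    ∃ M, 0 ≤ M ∧ ∀ s ∈ Icc a (a + R), ‖f s‖ ≤ M := by
  obtain ⟨M, hM⟩ := isCompact_Icc.exists_bound_of_continuousOn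
    (hf.mono fun s (hs : s ∈ Icc a (a + R)) => hs.1)
  exact ⟨max M 0, le_max_right _ _, fun s hs => (hM s hs).trans (le_max_left _ _)⟩

/-- A kernel `K r s`, continuous for `r > 0` and `s ≥ a`, which is dominated for small `r` by an
integrable function of `r` alone. -/
structure IsConvolutionKernel (a : ℝ) (K : ℝ → ℝ → E) : Prop where
  continuousOn : ContinuousOn (fun q : ℝ × ℝ => K q.1 q.2) (Ioi 0 ×ˢ Ici a)
  bound : ∀ R, ∃ b : ℝ → ℝ, IntegrableOn b (Ioc 0 R) ∧
    ∀ r ∈ Ioc 0 R, ∀ s ∈ Icc a (a + R), ‖K r s‖ ≤ b r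

namespace IsConvolutionKernel

variable {a : ℝ} {K : ℝ → ℝ → E}

lemma continuousOn_diag (h : IsConvolutionKernel a K) (t : ℝ) :
    ContinuousOn (fun r => K r (t - r)) (Ioc 0 (t - a)) :=
  h.continuousOn.comp (f := fun r => (r, t - r)) (by fun_prop) fun r hr =>
    ⟨hr.1, by have := hr.2; simp only [mem_Ici]; linarith⟩

lemma integrableOn_diag (h : IsConvolutionKernel a K) (t : ℝ) :
    IntegrableOn (fun r => K r (t - r)) (Ioc 0 (t - a)) := by
  obtain ⟨b, hb, hle⟩ := h.bound (t - a)
  refine Integrable.mono' hb ((h.continuousOn_diag t).aestronglyMeasurable measurableSet_Ioc) ?_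
  refine (ae_restrict_iff' measurableSet_Ioc).2 (ae_of_all _ fun r hr => hle r hr _ ?_)
  constructor <;> linarith [hr.1, hr.2]

lemma intervalIntegrable (h : IsConvolutionKernel a K) {t : ℝ} (ht : a ≤ t) :
    IntervalIntegrable (fun s => K (t - s) s) volume a t := by
  have h1 : IntervalIntegrable (fun r => K r (t - r)) volume 0 (t - a) :=
    (intervalIntegrable_iff_integrableOn_Ioc_of_le (by linarith)).2 (h.integrableOn_diag t)
  have h2 := (h1.comp_sub_left t).symm
  simpa using h2

variable [NormedSpace ℝ E]

lemma integral_eq (K : ℝ → ℝ → E) {t : ℝ} (ht : a ≤ t) :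
    ∫ s in a..t, K (t - s) s = ∫ r in Ioc 0 (t - a), K r (t - r) := by
  rw [← intervalIntegral.integral_of_le (by linarith)]
  have := intervalIntegral.integral_comp_sub_left (a := a) (b := t)
    (fun r => K r (t - r)) t
  simpa using this

lemma continuousOn_integral (h : IsConvolutionKernel a K) :
    ContinuousOn (fun t => ∫ s in a..t, K (t - s) s) (Ici a) := by
  intro t₀ ht₀
  have ht₀' : a ≤ t₀ := ht₀
  set R := t₀ - a + 1 with hR
  obtain ⟨b, hb, hle⟩ := h.bound R
  have hev : ∀ᶠ t in 𝓝[Ici a] t₀, t ∈ Icc a (a + R) := by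
    filter_upwards [self_mem_nhdsWithin, mem_nhdsWithin_of_mem_nhds
      (Iio_mem_nhds (by linarith : t₀ < a + R))] with t h1 h2
    exact ⟨h1, le_of_lt h2⟩
  have key : ContinuousWithinAt (fun t => ∫ r in Ioc 0 R,
      (Ioc 0 (t - a)).indicator (fun r => K r (t - r)) r) (Ici a) t₀ := by
    refine continuousWithinAt_of_dominated (bound := b) ?_ ?_ hb ?_
    · refine Eventually.of_forall fun t => ?_
      exact ((integrable_indicator_iff measurableSet_Ioc).2
        (h.integrableOn_diag t)).aestronglyMeasurable.restrict
    · filter_upwards [hev] with t ht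
      refine (ae_restrict_iff' measurableSet_Ioc).2 (ae_of_all _ fun r hr => ?_)
      by_cases hrt : r ∈ Ioc 0 (t - a)
      · rw [indicator_of_mem hrt]
        refine hle r hr _ ⟨?_, ?_⟩ <;> linarith [hrt.1, hrt.2, ht.2]
      · rw [indicator_of_notMem hrt, norm_zero]
        exact (norm_nonneg _).trans (hle r hr a ⟨le_rfl, by linarith⟩)
    · have hne : ∀ᵐ r ∂(volume.restrict (Ioc 0 R)), r ≠ t₀ - a :=
        ae_restrict_of_ae (compl_mem_ae_iff.2 (measure_singleton _))
      filter_upwards [hne, ae_restrict_mem measurableSet_Ioc] with r hr hr2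
      rcases lt_or_gt_of_ne hr with hlt | hgt
      · have h1 : ContinuousAt (fun t => K r (t - r)) t₀ := by
          have h2 := h.continuousOn.continuousAt (x := (r, t₀ - r))
            (prod_mem_nhds (Ioi_mem_nhds hr2.1) (Ici_mem_nhds (by linarith)))
          exact ContinuousAt.comp (f := fun t => (r, t - r)) h2 (by fun_prop)
        refine (h1.congr ?_).continuousWithinAt
        filter_upwards [Ioi_mem_nhds (by linarith : r + a < t₀)] with t ht
        rw [indicator_of_mem]
        exact ⟨hr2.1, by have : r + a < t := ht; linarith⟩
      · refine (continuousAt_const (y := (0 : E)).congr ?_).continuousWithinAt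
        filter_upwards [Iio_mem_nhds (by linarith : t₀ < r + a)] with t ht
        rw [indicator_of_notMem]
        intro hmem
        have : t < r + a := ht
        linarith [hmem.2]
  refine key.congr_of_eventuallyEq ?_ ?_
  · filter_upwards [hev] with t ht
    rw [integral_eq K ht.1, setIntegral_indicator measurableSet_Ioc,
      Ioc_inter_Ioc, max_self, min_eq_right (by linarith [ht.2])]
  · rw [integral_eq K ht₀', setIntegral_indicator measurableSet_Ioc,
      Ioc_inter_Ioc, max_self, min_eq_right (by linarith)]

end IsConvolutionKernel

end Convolution

namespace TorusRep

variable {n : ℕ} {E : Type*} [NormedAddCommGroup E] [NormedSpace ℝ E]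
  (T : TorusRep n E)

lemma isConvolutionKernel_poisson {f : ℝ → E} {a : ℝ} (hf : ContinuousOn f (Ici a)) :
    IsConvolutionKernel a fun r s => T.poisson r (f s) where
  continuousOn := T.continuous_poisson.comp_continuousOn
    (f := fun q : ℝ × ℝ => (q.1, f q.2)) (continuousOn_fst.prodMk
      (hf.comp continuousOn_snd fun q hq => hq.2))
  bound R := by
    obtain ⟨M, -, hM⟩ := exists_bound_of_continuousOn hf R
    exact ⟨fun _ => M, integrableOn_const measure_Ioc_lt_top.ne, fun r _ s hs =>
      (T.norm_poisson_le r _).trans (hM s hs)⟩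

/-- The variation of constants formula, started at time `a`. -/
def IsMildFrom (a : ℝ) (f g : ℝ → E) : Prop :=
  ∀ t, a ≤ t → g t = T.poisson (t - a) (g a) + ∫ s in a..t, T.poisson (t - s) (f s)

lemma norm_integral_exp_smul_le {L M t : ℝ} (hL : 0 < L) (ht : 0 ≤ t) (hM : 0 ≤ M) {F : ℝ → E}
    (hF : ∀ s ∈ Ioc 0 t, ‖F s‖ ≤ M) :
    ‖∫ s in (0 : ℝ)..t, Real.exp (-(L * (t - s))) • F s‖ ≤ M / L := by
  have hd : ∀ s : ℝ, HasDerivAt (fun s => M / L * Real.exp (-(L * (t - s))))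
      (Real.exp (-(L * (t - s))) * M) s := by
    intro s
    have h1 : HasDerivAt (fun s => -(L * (t - s))) (-(L * (0 - 1))) s :=
      (((hasDerivAt_const s t).sub (hasDerivAt_id s)).const_mul L).neg
    refine (h1.exp.const_mul (M / L)).congr_deriv ?_
    field_simp
    ring
  have hi : IntervalIntegrable (fun s => Real.exp (-(L * (t - s))) * M) volume 0 t :=
    Continuous.intervalIntegrable (by fun_prop) _ _
  refine (intervalIntegral.norm_integral_le_of_norm_le ht (ae_of_all _ fun s hs => ?_) hi).trans ?_
  · rw [norm_smul, Real.norm_of_nonneg (Real.exp_nonneg _)]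
    exact mul_le_mul_of_nonneg_left (hF s hs) (Real.exp_nonneg _)
  · rw [intervalIntegral.integral_eq_sub_of_hasDerivAt (fun s _ => hd s) hi]
    have h1 : 0 ≤ M / L := by positivity
    have h2 := Real.exp_nonneg (-(L * (t - 0)))
    simp only [sub_self, mul_zero, neg_zero, Real.exp_zero, mul_one]
    nlinarith [mul_nonneg h1 h2]

variable [CompleteSpace E]

lemma IsMildFrom.restart {f g : ℝ → E} {a b : ℝ} (hf : ContinuousOn f (Ici a))
    (h : T.IsMildFrom a f g) (hab : a ≤ b) : T.IsMildFrom b f g := by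
  intro t hbt
  have hk := T.isConvolutionKernel_poisson hf
  have h1 : ∫ s in a..b, T.poisson (t - s) (f s) =
      T.poisson (t - b) (∫ s in a..b, T.poisson (b - s) (f s)) := by
    rw [← ContinuousLinearMap.intervalIntegral_comp_comm _ (hk.intervalIntegrable hab)]
    refine intervalIntegral.integral_congr fun s hs => ?_
    rw [uIcc_of_le hab] at hs
    rw [← T.poisson_add (by linarith) (by linarith [hs.2])]
    congr 2
    ring
  have hi := hk.intervalIntegrable (hab.trans hbt)
  have hb : b ∈ uIcc a t := by rw [uIcc_of_le (hab.trans hbt)]; exact ⟨hab, hbt⟩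
  have h2 := intervalIntegral.integral_add_adjacent_intervals
    (hi.mono_set (uIcc_subset_uIcc_left hb)) (hi.mono_set (uIcc_subset_uIcc_right hb))
  rw [h t (hab.trans hbt), ← h2, h1, h b hab, map_add,
    ← T.poisson_add (by linarith) (by linarith), add_assoc]
  congr 3
  ring

lemma coeff_variation_of_constants {f : ℝ → E} {a t : ℝ} (hf : ContinuousOn f (Ici a))
    (hat : a ≤ t) (u : E) (k : Fin n → ℤ) :
    T.coeff k (T.poisson (t - a) u + ∫ s in a..t, T.poisson (t - s) (f s)) =
      (Real.exp (-(halfLaplaceSymbol k * (t - a))) : ℂ) * T.coeff k u +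
        ∫ s in a..t, (Real.exp (-(halfLaplaceSymbol k * (t - s))) : ℂ) * T.coeff k (f s) := by
  rw [map_add, T.coeff_poisson (by linarith),
    ← ContinuousLinearMap.intervalIntegral_comp_comm _
      ((T.isConvolutionKernel_poisson hf).intervalIntegrable hat)]
  congr 1
  refine intervalIntegral.integral_congr fun s hs => ?_
  rw [uIcc_of_le hat] at hs
  exact T.coeff_poisson (by linarith [hs.2]) _ _

open BoundedContinuousFunction in
/-- Existence of mild solutions for a Lipschitz nonlinearity. -/
theorem exists_isMildFrom {K : NNReal} {N : E → E} (hN : LipschitzWith K N) (u : E) :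
    ∃ g : ℝ → E, Continuous g ∧ g 0 = u ∧ T.IsMildFrom 0 (fun s => N (g s)) g := by
  set L : ℝ := K + 1 with hL
  have hLpos : 0 < L := by positivity
  let F : (ℝ →ᵇ E) → ℝ → E := fun w s => Real.exp (-(L * s)) • N (Real.exp (L * s) • w s)
  have hFc : ∀ w, Continuous (F w) := fun w =>
    (by fun_prop : Continuous fun s : ℝ => Real.exp (-(L * s))).smul
      (hN.continuous.comp ((by fun_prop : Continuous fun s : ℝ => Real.exp (L * s)).smul
        w.continuous))
  have hFd : ∀ w w' s, ‖F w s - F w' s‖ ≤ K * dist w w' := by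
    intro w w' s
    have h1 := hN.dist_le_mul (Real.exp (L * s) • w s) (Real.exp (L * s) • w' s)
    rw [dist_eq_norm, dist_eq_norm, ← smul_sub, norm_smul,
      Real.norm_of_nonneg (Real.exp_nonneg _)] at h1
    rw [← smul_sub, norm_smul, Real.norm_of_nonneg (Real.exp_nonneg _)]
    have h2 : ‖w s - w' s‖ ≤ dist w w' := by
      rw [← dist_eq_norm]
      exact dist_coe_le_dist s
    calc Real.exp (-(L * s)) * ‖N (Real.exp (L * s) • w s) - N (Real.exp (L * s) • w' s)‖
        ≤ Real.exp (-(L * s)) * (K * (Real.exp (L * s) * ‖w s - w' s‖)) := by gcongr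
      _ = (Real.exp (-(L * s)) * Real.exp (L * s)) * (K * ‖w s - w' s‖) := by ring
      _ = K * ‖w s - w' s‖ := by rw [← Real.exp_add]; simp
      _ ≤ K * dist w w' := by gcongr
  have hF0 : ∀ s, 0 ≤ s → ‖F 0 s‖ ≤ ‖N 0‖ := by
    intro s hs
    simp only [F, coe_zero, Pi.zero_apply, smul_zero, norm_smul]
    rw [Real.norm_of_nonneg (Real.exp_nonneg _)]
    exact mul_le_of_le_one_left (norm_nonneg _) (Real.exp_le_one_iff.2 (by
      have := mul_nonneg hLpos.le hs
      linarith))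
  have hFb : ∀ w s, 0 ≤ s → ‖F w s‖ ≤ ‖N 0‖ + K * dist w 0 := by
    intro w s hs
    have h1 : F w s = F 0 s + (F w s - F 0 s) := by abel
    rw [h1]
    exact (norm_add_le _ _).trans (add_le_add (hF0 s hs) (hFd w 0 s))
  have hker : ∀ w, IsConvolutionKernel 0
      fun r s => Real.exp (-(L * r)) • T.poisson r (F w s) := fun w =>
    { continuousOn := ((by fun_prop : Continuous fun q : ℝ × ℝ => Real.exp (-(L * q.1))).smul
        (T.continuous_poisson.comp (f := fun q : ℝ × ℝ => (q.1, F w q.2))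
          (continuous_fst.prodMk ((hFc w).comp continuous_snd)))).continuousOn
      bound := fun R => ⟨fun _ => ‖N 0‖ + K * dist w 0,
        integrableOn_const measure_Ioc_lt_top.ne, fun r hr s hs => by
          rw [norm_smul, Real.norm_of_nonneg (Real.exp_nonneg _)]
          have h1 : Real.exp (-(L * r)) ≤ 1 := Real.exp_le_one_iff.2 (by
            have := mul_nonneg hLpos.le hr.1.le
            linarith)
          exact (mul_le_of_le_one_left (norm_nonneg _) h1).trans
            ((T.norm_poisson_le _ _).trans (hFb w s hs.1))⟩ }
  let Ψ : (ℝ →ᵇ E) → ℝ → E := fun w t => Real.exp (-(L * t)) • T.poisson t u +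
    ∫ s in (0 : ℝ)..t, Real.exp (-(L * (t - s))) • T.poisson (t - s) (F w s)
  have hΨc : ∀ w, ContinuousOn (Ψ w) (Ici 0) := fun w =>
    ((by fun_prop : Continuous fun t : ℝ => Real.exp (-(L * t))).smul
      (T.continuous_avg _ u)).continuousOn.add (hker w).continuousOn_integral
  have hΨb : ∀ w t, 0 ≤ t → ‖Ψ w t‖ ≤ ‖u‖ + (‖N 0‖ + K * dist w 0) / L := by
    intro w t ht
    refine (norm_add_le _ _).trans (add_le_add ?_ ?_)
    · rw [norm_smul, Real.norm_of_nonneg (Real.exp_nonneg _)]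
      exact (mul_le_of_le_one_left (norm_nonneg _) (Real.exp_le_one_iff.2 (by
        have := mul_nonneg hLpos.le ht
        linarith))).trans (T.norm_poisson_le _ _)
    · exact norm_integral_exp_smul_le hLpos ht (by positivity) fun s hs =>
        (T.norm_poisson_le _ _).trans (hFb w s hs.1.le)
  let Φ : (ℝ →ᵇ E) → (ℝ →ᵇ E) := fun w => ofNormedAddCommGroup (fun t => Ψ w (max t 0))
    ((hΨc w).comp_continuous (by fun_prop) fun t => mem_Ici.2 (le_max_right _ _)) _
    fun t => hΨb w _ (le_max_right _ _)
  have hΦ : ContractingWith (K / (K + 1)) Φ := by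
    refine ⟨by
      rw [div_lt_one (by positivity)]
      exact lt_add_of_pos_right _ one_pos, LipschitzWith.of_dist_le_mul fun w w' => ?_⟩
    rw [dist_le (by positivity)]
    intro t
    change dist (Ψ w (max t 0)) (Ψ w' (max t 0)) ≤ _
    have ht : 0 ≤ max t 0 := le_max_right _ _
    generalize max t 0 = t at ht
    rw [dist_eq_norm]
    have h1 : Ψ w t - Ψ w' t = ∫ s in (0 : ℝ)..t,
        Real.exp (-(L * (t - s))) • T.poisson (t - s) (F w s - F w' s) := by
      simp only [Ψ, add_sub_add_left_eq_sub]
      rw [← intervalIntegral.integral_sub ((hker w).intervalIntegrable ht)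
        ((hker w').intervalIntegrable ht)]
      simp only [map_sub, smul_sub]
    rw [h1]
    refine (norm_integral_exp_smul_le hLpos ht (M := K * dist w w') (by positivity) fun s hs =>
      (T.norm_poisson_le _ _).trans (hFd w w' s)).trans (le_of_eq ?_)
    push_cast
    rw [hL]
    ring
  set w := hΦ.fixedPoint Φ
  have hw : Φ w = w := hΦ.fixedPoint_isFixedPt
  have hwt : ∀ t, 0 ≤ t → w t = Ψ w t := by
    intro t ht
    have h1 : Φ w t = Ψ w (max t 0) := rfl
    rw [hw, max_eq_left ht] at h1
    exact h1
  have h0 : w 0 = u := by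
    rw [hwt 0 le_rfl]
    simp [Ψ, T.poisson_zero]
  refine ⟨fun t => Real.exp (L * t) • w t, (by fun_prop : Continuous fun t : ℝ =>
    Real.exp (L * t)).smul w.continuous, by simp [h0], fun t ht => ?_⟩
  simp only [mul_zero, Real.exp_zero, one_smul, h0, sub_zero]
  rw [hwt t ht]
  simp only [Ψ, smul_add, smul_smul, ← Real.exp_add, add_neg_cancel, Real.exp_zero, one_smul]
  congr 1
  rw [← intervalIntegral.integral_smul]
  refine intervalIntegral.integral_congr fun s _ => ?_
  simp only [F, map_smul, smul_smul, ← Real.exp_add]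
  rw [show L * t + (-(L * (t - s)) + -(L * s)) = 0 by ring, Real.exp_zero, one_smul]

end TorusRep

lemma integrableOn_inv_sqrt (R : ℝ) : IntegrableOn (fun r : ℝ => (√r)⁻¹) (Ioc 0 R) := by
  rcases le_total 0 R with hR | hR
  · have h := intervalIntegral.intervalIntegrable_rpow' (a := 0) (b := R) (r := -(1 / 2))
      (by norm_num)
    rw [intervalIntegrable_iff_integrableOn_Ioc_of_le hR] at h
    refine h.congr_fun (fun r hr => ?_) measurableSet_Ioc
    simp only
    rw [Real.rpow_neg hr.1.le, Real.sqrt_eq_rpow]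
  · rw [Ioc_eq_empty (not_lt.2 hR)]
    exact integrableOn_empty

lemma hasDerivAt_integral_of_continuousOn {E : Type*} [NormedAddCommGroup E] [NormedSpace ℝ E]
    [CompleteSpace E] {f : ℝ → E} {a b t : ℝ} (hf : ContinuousOn f (Ioi a))
    (hi : IntervalIntegrable f volume b t) (ht : a < t) :
    HasDerivAt (fun t => ∫ s in b..t, f s) (f t) t :=
  intervalIntegral.integral_hasDerivAt_right hi
    (hf.stronglyMeasurableAtFilter isOpen_Ioi t ht) (hf.continuousAt (Ioi_mem_nhds ht))

namespace TorusRep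

variable {n : ℕ} {E : Type*} [NormedAddCommGroup E] [NormedSpace ℝ E]
  (T : TorusRep n E)

/-- A family of elements of `E` which represents the gradient of `u`. -/
def IsGradient (u : E) (v : Fin n → E) : Prop :=
  ∀ j k, T.coeff k (v j) = partialSymbol j k * T.coeff k u

/-- The differential of `y ↦ shift y u` at `y`, in terms of the gradient of `u`. -/
def shiftFDeriv (v : Fin n → E) (y : Fin n → ℝ) : (Fin n → ℝ) →L[ℝ] E :=
  ∑ j, (ContinuousLinearMap.proj j : (Fin n → ℝ) →L[ℝ] ℝ).smulRight (T.shift y (v j))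

lemma shiftFDeriv_apply (v : Fin n → E) (y z : Fin n → ℝ) :
    T.shiftFDeriv v y z = ∑ j, z j • T.shift y (v j) := by
  simp [shiftFDeriv]

lemma coeff_sum_smul {u : E} {v : Fin n → E} (h : T.IsGradient u v) (y : Fin n → ℝ)
    (k : Fin n → ℤ) : T.coeff k (∑ j, y j • v j) = Complex.I * phase k y * T.coeff k u := by
  simp only [map_sum, map_smul, h _ k, partialSymbol, phase]
  rw [Complex.ofReal_sum, Finset.mul_sum, Finset.sum_mul]
  refine Finset.sum_congr rfl fun j _ => ?_
  rw [Complex.real_smul]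
  push_cast
  ring

lemma continuous_shift_uncurry : Continuous fun q : (Fin n → ℝ) × E => T.shift q.1 q.2 := by
  refine continuous_prod_of_continuous_lipschitzWith' (fun q : (Fin n → ℝ) × E =>
    T.shift q.1 q.2) 1 (fun y => ?_) T.continuous_shift
  refine LipschitzWith.of_dist_le_mul fun u v => ?_
  rw [dist_eq_norm, dist_eq_norm, ← map_sub, NNReal.coe_one, one_mul]
  exact T.norm_shift_le y _

variable [CompleteSpace E]

/-- `f` is Hölder continuous of exponent `1/2` in space, uniformly on bounded sets of times after
`a`. -/
def IsSpaceHolder (a : ℝ) (f : ℝ → E) : Prop :=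
  ∀ R, ∃ H, 0 ≤ H ∧ ∀ s ∈ Icc a (a + R), ∀ j h,
    ‖T.shift (Pi.single j h) (f s) - f s‖ ≤ H * √|h|

lemma IsMildFrom.isSpaceHolder {f g : ℝ → E} {a b : ℝ} (hf : ContinuousOn f (Ici a))
    (hm : T.IsMildFrom a f g) (hab : a < b) : T.IsSpaceHolder b g := by
  intro R
  obtain ⟨C, hC0, hC⟩ := T.norm_shift_poisson_sub_le
  obtain ⟨M, hM0, hM⟩ := exists_bound_of_continuousOn hf (b - a + R)
  set I := ∫ r in Ioc 0 (b - a + R), (√r)⁻¹ with hI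
  have hI0 : 0 ≤ I := integral_nonneg fun r => by positivity
  refine ⟨C * ‖g a‖ / √(b - a) + C * M * I, by positivity, fun t ht j h => ?_⟩
  have hat : a ≤ t := hab.le.trans ht.1
  have hk := (T.isConvolutionKernel_poisson hf).intervalIntegrable hat
  set D : E →L[ℝ] E := T.shift (Pi.single j h) - ContinuousLinearMap.id ℝ E with hD
  have h1 : T.shift (Pi.single j h) (g t) - g t =
      D (T.poisson (t - a) (g a)) + ∫ s in a..t, D (T.poisson (t - s) (f s)) := by
    rw [ContinuousLinearMap.intervalIntegral_comp_comm _ hk, ← map_add, ← hm t hat]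
    simp [hD]
  rw [h1, add_mul]
  have h2 : ‖D (T.poisson (t - a) (g a))‖ ≤ C * ‖g a‖ / √(b - a) * √|h| := by
    refine (hC (g a) j h (t - a) (by linarith [ht.1])).trans ?_
    rw [mul_div_right_comm]
    have : √(b - a) ≤ √(t - a) := Real.sqrt_le_sqrt (by linarith [ht.1])
    have hpos : 0 < √(b - a) := Real.sqrt_pos.2 (by linarith)
    gcongr
  have h3 : ‖∫ s in a..t, D (T.poisson (t - s) (f s))‖ ≤ C * M * I * √|h| := by
    rw [IsConvolutionKernel.integral_eq (fun r s => D (T.poisson r (f s))) hat]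
    have h4 : C * M * I * √|h| = ∫ r in Ioc 0 (b - a + R), C * M * √|h| * (√r)⁻¹ := by
      rw [integral_const_mul, hI]
      ring
    have h5 : IntegrableOn (fun r : ℝ => C * M * √|h| * (√r)⁻¹) (Ioc 0 (b - a + R)) :=
      (integrableOn_inv_sqrt _).const_mul _
    have hsub : Ioc 0 (t - a) ⊆ Ioc 0 (b - a + R) := Ioc_subset_Ioc_right (by linarith [ht.2])
    rw [h4]
    refine (norm_integral_le_of_norm_le (h5.mono_set hsub) ?_).trans
      (setIntegral_mono_set h5 (ae_of_all _ fun r => by positivity) hsub.eventuallyLE)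
    refine (ae_restrict_iff' measurableSet_Ioc).2 (ae_of_all _ fun r hr => ?_)
    have hrs : t - r ∈ Icc a (a + (b - a + R)) := by
      constructor <;> linarith [hr.1, hr.2, ht.2]
    refine (hC _ j h r hr.1).trans ?_
    rw [div_eq_mul_inv, mul_assoc C M, mul_assoc C, mul_assoc C, mul_assoc C]
    have := hM _ hrs
    gcongr
  exact (norm_add_le _ _).trans (add_le_add h2 h3)

/-- Maximal regularity: the space derivatives of order one of a mild solution exist and are
continuous in time if the right-hand side is Hölder continuous in space. -/
lemma IsMildFrom.exists_multiplier {f g : ℝ → E} {a : ℝ} (hf : ContinuousOn f (Ici a))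
    (hm : T.IsMildFrom a f g) (hH : T.IsSpaceHolder a f) {w : Weight n}
    {m : (Fin n → ℤ) → ℂ} (hw : w.Generates m) (h0 : w.symb 0 = 0) (hr : w.HasRootMoment) :
    ∃ v : ℝ → E, ContinuousOn v (Ioi a) ∧
      ∀ t, a < t → ∀ k, T.coeff k (v t) = m k * T.coeff k (g t) := by
  obtain ⟨C, hC0, hC⟩ := T.norm_avg_le_sqrt h0 hr
  have hker : IsConvolutionKernel a fun r s => r⁻¹ • T.avg w r (f s) :=
    { continuousOn := by
        refine ContinuousOn.smul (continuousOn_fst.inv₀ fun q hq => ne_of_gt hq.1) ?_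
        exact (T.continuous_avg_uncurry w).comp_continuousOn
          (f := fun q : ℝ × ℝ => (q.1, f q.2)) (continuousOn_fst.prodMk
            (hf.comp continuousOn_snd fun q hq => hq.2))
      bound := fun R => by
        obtain ⟨H, -, hH'⟩ := hH R
        refine ⟨fun r => C * H * (√r)⁻¹, (integrableOn_inv_sqrt R).const_mul _,
          fun r hr s hs => ?_⟩
        rw [norm_smul, norm_inv, Real.norm_of_nonneg hr.1.le]
        have h1 := hC (f s) H (hH' s hs) r hr.1.le
        have h2 : r⁻¹ * √r = (√r)⁻¹ := by
          rw [inv_mul_eq_div, Real.sqrt_div_self]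
        calc r⁻¹ * ‖T.avg w r (f s)‖ ≤ r⁻¹ * (C * H * √r) :=
              mul_le_mul_of_nonneg_left h1 (inv_nonneg.2 hr.1.le)
          _ = C * H * (r⁻¹ * √r) := by ring
          _ = _ := by rw [h2] }
  refine ⟨fun t => (t - a)⁻¹ • T.avg w (t - a) (g a) +
    ∫ s in a..t, (t - s)⁻¹ • T.avg w (t - s) (f s), ?_, fun t ht k => ?_⟩
  · refine ContinuousOn.add ?_ (hker.continuousOn_integral.mono Ioi_subset_Ici_self)
    refine ContinuousOn.smul (ContinuousOn.inv₀ (by fun_prop) fun t ht => ?_)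
      ((T.continuous_avg w (g a)).comp (continuous_id.sub continuous_const)).continuousOn
    exact sub_ne_zero.2 (ne_of_gt ht)
  · rw [map_add, T.coeff_inv_smul_avg hw (sub_pos.2 ht), hm t ht.le, map_add, mul_add]
    congr 1
    rw [← ContinuousLinearMap.intervalIntegral_comp_comm _ (hker.intervalIntegrable ht.le),
      ← ContinuousLinearMap.intervalIntegral_comp_comm _
        ((T.isConvolutionKernel_poisson hf).intervalIntegrable ht.le),
      ← intervalIntegral.integral_const_mul]
    refine intervalIntegral.integral_congr_ae ?_
    filter_upwards [compl_mem_ae_iff.2 (measure_singleton t)] with s hs hs2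
    rw [uIoc_of_le ht.le] at hs2
    exact T.coeff_inv_smul_avg hw (sub_pos.2 (lt_of_le_of_ne hs2.2 hs)) _ k

lemma IsMildFrom.hasDerivAt_coeff {f g : ℝ → E} {a t : ℝ} (hf : ContinuousOn f (Ici a))
    (hm : T.IsMildFrom a f g) (ht : a < t) (k : Fin n → ℤ) :
    HasDerivAt (fun t => T.coeff k (g t))
      (-(halfLaplaceSymbol k : ℂ) * T.coeff k (g t) + T.coeff k (f t)) t := by
  set l := halfLaplaceSymbol k with hl
  set φ : ℝ → ℂ := fun s => (Real.exp (l * s) : ℂ) * T.coeff k (f s) with hφ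
  have hφc : ContinuousOn φ (Ici a) :=
    (by fun_prop : Continuous fun s : ℝ => (Real.exp (l * s) : ℂ)).continuousOn.mul
      ((T.coeff k).continuous.comp_continuousOn hf)
  have hi : IntervalIntegrable φ volume a t :=
    (hφc.mono (by rw [uIcc_of_le ht.le]; exact Icc_subset_Ici_self)).intervalIntegrable
  have hrep : ∀ s, a ≤ s → T.coeff k (g s) = (Real.exp (-(l * s)) : ℂ) *
      ((Real.exp (l * a) : ℂ) * T.coeff k (g a) + ∫ x in a..s, φ x) := by
    intro s hs
    rw [hm s hs, T.coeff_variation_of_constants hf hs, ← hl, mul_add, ← mul_assoc,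
      ← Complex.ofReal_mul, ← Real.exp_add, ← intervalIntegral.integral_const_mul]
    congr 3
    · ring_nf
    · funext x
      rw [hφ]
      simp only
      rw [← mul_assoc, ← Complex.ofReal_mul, ← Real.exp_add]
      ring_nf
  have hd := (hasDerivAt_integral_of_continuousOn (hφc.mono Ioi_subset_Ici_self) hi ht).const_add
    ((Real.exp (l * a) : ℂ) * T.coeff k (g a))
  have he : HasDerivAt (fun s : ℝ => (Real.exp (-(l * s)) : ℂ))
      ((Real.exp (-(l * t)) * -(l * 1) : ℝ) : ℂ) t :=
    (((hasDerivAt_id t).const_mul l).neg.exp).ofReal_comp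
  have hev : (fun t => T.coeff k (g t)) =ᶠ[𝓝 t] fun s => (Real.exp (-(l * s)) : ℂ) *
      ((Real.exp (l * a) : ℂ) * T.coeff k (g a) + ∫ x in a..s, φ x) := by
    filter_upwards [Ioi_mem_nhds ht] with s hs using hrep s (le_of_lt hs)
  refine ((he.mul hd).congr_of_eventuallyEq hev).congr_deriv ?_
  have h1 : (Real.exp (-(l * t)) : ℂ) * φ t = T.coeff k (f t) := by
    rw [hφ]
    simp only
    rw [← mul_assoc, ← Complex.ofReal_mul, ← Real.exp_add, neg_add_cancel, Real.exp_zero,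
      Complex.ofReal_one, one_mul]
  rw [h1, hrep t ht.le]
  push_cast
  ring

/-- A mild solution is differentiable in time if its half Laplacian exists and is continuous. -/
lemma IsMildFrom.hasDerivAt {f g v : ℝ → E} {a t : ℝ} (hf : ContinuousOn f (Ici a))
    (hm : T.IsMildFrom a f g) (hv : ContinuousOn v (Ioi a))
    (hvg : ∀ t, a < t → ∀ k, T.coeff k (v t) = (halfLaplaceSymbol k : ℂ) * T.coeff k (g t))
    (ht : a < t) : HasDerivAt g (-v t + f t) t := by
  have hF : ContinuousOn (fun s => -v s + f s) (Ioi a) :=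
    hv.neg.add (hf.mono Ioi_subset_Ici_self)
  obtain ⟨b, hab, hbt⟩ := exists_between ht
  have hi : ∀ s, a < s → IntervalIntegrable (fun s => -v s + f s) volume b s := fun s hs =>
    (hF.mono fun x hx => lt_of_lt_of_le (lt_min hab hs) hx.1).intervalIntegrable
  have hrep : ∀ s, a < s → g s = g b + ∫ x in b..s, (-v x + f x) := by
    intro s hs
    refine T.ext_coeff fun k => ?_
    rw [map_add, ← ContinuousLinearMap.intervalIntegral_comp_comm _ (hi s hs)]
    have hd : ∀ x ∈ uIcc b s, HasDerivAt (fun t => T.coeff k (g t))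
        (T.coeff k (-v x + f x)) x := by
      intro x hx
      have hax : a < x := lt_of_lt_of_le (lt_min hab hs) hx.1
      refine (IsMildFrom.hasDerivAt_coeff T hf hm hax k).congr_deriv ?_
      rw [map_add, map_neg, hvg x hax, neg_mul]
    rw [intervalIntegral.integral_eq_sub_of_hasDerivAt hd
      ⟨(T.coeff k).integrable_comp (hi s hs).1, (T.coeff k).integrable_comp (hi s hs).2⟩]
    ring
  refine ((hasDerivAt_integral_of_continuousOn hF (hi t ht) ht).const_add (g b)).congr_of_eventuallyEq
    ?_
  filter_upwards [Ioi_mem_nhds ht] with s hs using hrep s hs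

lemma hasFDerivAt_shift_zero {u : E} {v : Fin n → E} (h : T.IsGradient u v) :
    HasFDerivAt (fun y => T.shift y u) (T.shiftFDeriv v 0) 0 := by
  rw [hasFDerivAt_iff_isLittleO_nhds_zero, Asymptotics.isLittleO_iff]
  intro c hc
  have hcont : ∀ j, ∀ᶠ y in 𝓝 (0 : Fin n → ℝ), ‖T.shift y (v j) - v j‖ < c / (n + 1) := by
    intro j
    have h1 : Tendsto (fun y => ‖T.shift y (v j) - v j‖) (𝓝 0) (𝓝 ‖T.shift 0 (v j) - v j‖) :=
      (((T.continuous_shift (v j)).sub continuous_const).norm).tendsto 0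
    rw [T.shift_zero, sub_self, norm_zero] at h1
    exact h1.eventually_lt_const (by positivity)
  obtain ⟨δ, hδ, hball⟩ := Metric.eventually_nhds_iff_ball.1 (eventually_all.2 hcont)
  filter_upwards [Metric.ball_mem_nhds _ hδ] with y hy
  have hy' : ‖y‖ < δ := by simpa using hy
  rw [zero_add, T.shift_zero, shiftFDeriv_apply]
  simp only [T.shift_zero]
  rw [T.shift_sub_eq_integral y (T.coeff_sum_smul h y)]
  have h1 : ∑ j, y j • v j = ∫ _ in (0 : ℝ)..1, ∑ j, y j • v j := by simp
  rw [h1, ← intervalIntegral.integral_sub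
    ((T.continuous_shift_smul y _).intervalIntegrable _ _) (by simp)]
  have h2 : ∀ s ∈ uIoc (0 : ℝ) 1,
      ‖T.shift (s • y) (∑ j, y j • v j) - ∑ j, y j • v j‖ ≤ c * ‖y‖ := by
    intro s hs
    rw [uIoc_of_le zero_le_one] at hs
    rw [map_sum, ← Finset.sum_sub_distrib]
    refine (norm_sum_le _ _).trans ?_
    have hsy : s • y ∈ Metric.ball (0 : Fin n → ℝ) δ := by
      rw [mem_ball_zero_iff, norm_smul, Real.norm_of_nonneg hs.1.le]
      exact (mul_le_of_le_one_left (norm_nonneg _) hs.2).trans_lt hy'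
    have h3 : ∀ j ∈ Finset.univ, ‖T.shift (s • y) (y j • v j) - y j • v j‖ ≤
        ‖y‖ * (c / (n + 1)) := by
      intro j _
      rw [map_smul, ← smul_sub, norm_smul]
      exact mul_le_mul (norm_le_pi_norm y j) (hball _ hsy j).le (norm_nonneg _) (norm_nonneg _)
    refine (Finset.sum_le_sum h3).trans ?_
    rw [Finset.sum_const, Finset.card_univ, Fintype.card_fin, nsmul_eq_mul]
    have h4 : (n : ℝ) * (c / (n + 1)) ≤ c := by
      rw [mul_div_assoc', div_le_iff₀ (by positivity)]
      nlinarith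
    calc (n : ℝ) * (‖y‖ * (c / (n + 1))) = (n * (c / (n + 1))) * ‖y‖ := by ring
      _ ≤ c * ‖y‖ := mul_le_mul_of_nonneg_right h4 (norm_nonneg _)
  simpa using intervalIntegral.norm_integral_le_of_norm_le_const h2

lemma hasFDerivAt_shift {u : E} {v : Fin n → E} (h : T.IsGradient u v) (y : Fin n → ℝ) :
    HasFDerivAt (fun y => T.shift y u) (T.shiftFDeriv v y) y := by
  have h1 : (fun x => T.shift x u) = fun x => T.shift y (T.shift (x - y) u) := by
    funext x
    rw [← T.shift_add, add_sub_cancel]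
  have h2 : HasFDerivAt (fun x => T.shift (x - y) u) (T.shiftFDeriv v 0) y := by
    have h3 : HasFDerivAt (fun y => T.shift y u) (T.shiftFDeriv v 0) ((fun x => x - y) y) := by
      simpa using T.hasFDerivAt_shift_zero h
    exact HasFDerivAt.comp (f := fun x => x - y) y h3 ((hasFDerivAt_id y).sub_const y)
  rw [h1]
  refine ((T.shift y).hasFDerivAt.comp y h2).congr_fderiv ?_
  ext z
  simp [shiftFDeriv_apply, T.shift_zero]

/-- A curve with continuous time derivative and continuous gradient defines a function of class
`C¹` in space and time. -/
lemma contDiffOn_shift {J : Set ℝ} (hJ : IsOpen J) {g g' : ℝ → E} {v : Fin n → ℝ → E}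
    (hg : ∀ t ∈ J, HasDerivAt g (g' t) t) (hg' : ContinuousOn g' J)
    (hv : ∀ j, ContinuousOn (v j) J) (hgv : ∀ t ∈ J, T.IsGradient (g t) fun j => v j t) :
    ContDiffOn ℝ 1 (fun p : ℝ × (Fin n → ℝ) => T.shift p.2 (g p.1)) (J ×ˢ univ) := by
  have hopen : IsOpen (J ×ˢ (univ : Set (Fin n → ℝ))) := hJ.prod isOpen_univ
  set f₁ : ℝ → (Fin n → ℝ) → ℝ →L[ℝ] E := fun t y =>
    (1 : ℝ →L[ℝ] ℝ).smulRight (T.shift y (g' t)) with hf₁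
  set f₂ : ℝ → (Fin n → ℝ) → (Fin n → ℝ) →L[ℝ] E := fun t y =>
    T.shiftFDeriv (fun j => v j t) y with hf₂
  have hcs : ∀ w : ℝ → E, ContinuousOn w J →
      ContinuousOn (fun p : ℝ × (Fin n → ℝ) => T.shift p.2 (w p.1)) (J ×ˢ univ) := fun w hw =>
    T.continuous_shift_uncurry.comp_continuousOn
      (f := fun p : ℝ × (Fin n → ℝ) => (p.2, w p.1)) (continuousOn_snd.prodMk
        (hw.comp continuousOn_fst fun p hp => hp.1))
  have hc₁ : ContinuousOn (fun p : ℝ × (Fin n → ℝ) => f₁ p.1 p.2) (J ×ˢ univ) :=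
    (ContinuousLinearMap.smulRightL ℝ ℝ E 1).continuous.comp_continuousOn (hcs g' hg')
  have hc₂ : ContinuousOn (fun p : ℝ × (Fin n → ℝ) => f₂ p.1 p.2) (J ×ˢ univ) :=
    continuousOn_finsetSum _ fun j _ =>
      (ContinuousLinearMap.smulRightL ℝ (Fin n → ℝ) E
        (ContinuousLinearMap.proj j)).continuous.comp_continuousOn (hcs (v j) (hv j))
  have hd : ∀ p ∈ J ×ˢ (univ : Set (Fin n → ℝ)),
      HasFDerivAt (fun p : ℝ × (Fin n → ℝ) => T.shift p.2 (g p.1))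
        ((f₁ p.1 p.2).coprod (f₂ p.1 p.2)) p := by
    intro p hp
    have hnhds := hopen.mem_nhds hp
    refine (hasStrictFDerivAt_uncurry_coprod (f := fun t y => T.shift y (g t)) (f₁ := f₁)
      (f₂ := f₂) ?_ ?_ (hc₁.continuousAt hnhds) (hc₂.continuousAt hnhds)).hasFDerivAt
    · filter_upwards [hnhds] with q hq
      exact ((T.shift q.2).hasFDerivAt.comp_hasDerivAt q.1 (hg q.1 hq.1)).hasFDerivAt
    · filter_upwards [hnhds] with q hq
      exact T.hasFDerivAt_shift (hgv q.1 hq.1) q.2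
  rw [show (1 : WithTop ℕ∞) = 0 + 1 from rfl, contDiffOn_succ_iff_fderiv_of_isOpen hopen]
  refine ⟨fun p hp => (hd p hp).differentiableAt.differentiableWithinAt, by simp, ?_⟩
  rw [contDiffOn_zero]
  have hc : ContinuousOn (fun p : ℝ × (Fin n → ℝ) => (f₁ p.1 p.2).coprod (f₂ p.1 p.2))
      (J ×ˢ univ) := by
    have := (ContinuousLinearMap.coprodEquivL (𝕜 := ℝ) (S := ℝ) (E := ℝ) (F := Fin n → ℝ)
      (G := E)).continuous.comp_continuousOn (hc₁.prodMk hc₂)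
    exact this
  exact hc.congr fun p hp => (hd p hp).fderiv

end TorusRep

variable {n : ℕ}

lemma torusFourierCoeff_def (u : Torus n → ℝ) (k : Fin n → ℤ) :
    torusFourierCoeff u k =
      ∫ x, UnitAddTorus.mFourier (-k) x • (u x : ℂ) ∂Torus.measure n := rfl

lemma torusFourierCoeff_congr {u v : Torus n → ℝ} (h : u =ᵐ[Torus.measure n] v)
    (k : Fin n → ℤ) : torusFourierCoeff u k = torusFourierCoeff v k := by
  rw [torusFourierCoeff_def, torusFourierCoeff_def]
  refine integral_congr_ae ?_
  filter_upwards [h] with x hx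
  rw [hx]

/-- The inclusion of real-valued into complex-valued square integrable functions. -/
def complexify (n : ℕ) : L2 n →L[ℝ] Lp ℂ 2 (Torus.measure n) :=
  Complex.ofRealCLM.compLpL 2 (Torus.measure n)

lemma complexify_ae (u : L2 n) : complexify n u =ᵐ[Torus.measure n] fun x => (u x : ℂ) :=
  Complex.ofRealCLM.coeFn_compLp u

/-- The Fourier coefficients of square integrable functions as continuous linear functionals. -/
def l2Coeff (k : Fin n → ℤ) : L2 n →L[ℝ] ℂ :=
  ((innerSL ℂ (UnitAddTorus.mFourierLp 2 k :
    Lp ℂ 2 (Torus.measure n))).restrictScalars ℝ).comp (complexify n)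

lemma repr_mFourierBasis (u : Lp ℂ 2 (Torus.measure n)) (k : Fin n → ℤ) :
    UnitAddTorus.mFourierBasis.repr u k = UnitAddTorus.mFourierCoeff u k :=
  UnitAddTorus.mFourierBasis_repr u k

lemma l2Coeff_eq_repr (u : L2 n) (k : Fin n → ℤ) :
    l2Coeff k u = UnitAddTorus.mFourierBasis.repr (complexify n u) k := by
  rw [HilbertBasis.repr_apply_apply, UnitAddTorus.coe_mFourierBasis]
  rfl

lemma l2Coeff_apply (u : L2 n) (k : Fin n → ℤ) : l2Coeff k u = torusFourierCoeff u k := by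
  rw [l2Coeff_eq_repr, repr_mFourierBasis, torusFourierCoeff_def]
  refine integral_congr_ae ?_
  filter_upwards [complexify_ae u] with x hx
  rw [hx]

lemma eq_zero_of_l2Coeff {u : L2 n} (h : ∀ k, l2Coeff k u = 0) : u = 0 := by
  have h1 : UnitAddTorus.mFourierBasis.repr (complexify n u) = 0 := by
    ext k
    rw [← l2Coeff_eq_repr, h k]
    rfl
  have h2 : complexify n u = 0 := (LinearIsometryEquiv.map_eq_zero_iff _).1 h1
  have h3 := complexify_ae u
  rw [h2] at h3
  rw [Lp.eq_zero_iff_ae_eq_zero]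
  filter_upwards [h3, Lp.coeFn_zero ℂ 2 (Torus.measure n)] with x hx hx0
  rw [hx0] at hx
  simpa using hx.symm

lemma norm_l2Coeff_le (u : L2 n) (k : Fin n → ℤ) : ‖l2Coeff k u‖ ≤ ‖u‖ := by
  have h1 : ‖(UnitAddTorus.mFourierLp 2 k : Lp ℂ 2 (Torus.measure n))‖ = 1 :=
    UnitAddTorus.orthonormal_mFourier.1 k
  have h2 : ‖complexify n u‖ ≤ ‖u‖ := by
    refine (ContinuousLinearMap.norm_compLp_le _ _).trans ?_
    simp
  refine (norm_inner_le_norm (𝕜 := ℂ)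
    (UnitAddTorus.mFourierLp 2 k : Lp ℂ 2 (Torus.measure n)) (complexify n u)).trans ?_
  rw [h1, one_mul]
  exact h2

lemma mFourier_mk (k : Fin n → ℤ) (y : Fin n → ℝ) :
    UnitAddTorus.mFourier k (Torus.mk y) = Complex.exp (Complex.I * phase k y) := by
  simp only [UnitAddTorus.mFourier, ContinuousMap.coe_mk, Torus.mk, fourier_coe_apply]
  rw [← Complex.exp_sum, phase, Complex.ofReal_sum, Finset.mul_sum]
  congr 1
  refine Finset.sum_congr rfl fun i _ => ?_
  push_cast
  ring

lemma mFourier_mul_arg (k : Fin n → ℤ) (x y : Torus n) :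
    UnitAddTorus.mFourier k (x + y) =
      UnitAddTorus.mFourier k x * UnitAddTorus.mFourier k y := by
  simp only [UnitAddTorus.mFourier, ContinuousMap.coe_mk, ← Finset.prod_mul_distrib]
  refine Finset.prod_congr rfl fun i _ => ?_
  rw [Pi.add_apply, fourier_apply, fourier_apply, fourier_apply, smul_add,
    AddCircle.toCircle_add, Circle.coe_mul]

lemma continuous_torusMk : Continuous (Torus.mk : (Fin n → ℝ) → Torus n) :=
  continuous_pi fun i => (AddCircle.continuous_mk' 1).comp (continuous_apply i)

lemma torusMk_surjective (x : Torus n) : ∃ y, Torus.mk y = x := by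
  choose y hy using fun i => QuotientAddGroup.mk_surjective (x i)
  exact ⟨y, funext hy⟩

/-- The translation by `a` as a continuous map of the torus. -/
def translation (a : Torus n) : C(Torus n, Torus n) := ⟨fun x => x + a, by fun_prop⟩

lemma measurePreserving_translation (a : Torus n) :
    MeasurePreserving (translation a) (Torus.measure n) (Torus.measure n) :=
  measurePreserving_add_right (Torus.measure n) a

lemma continuous_translation : Continuous (translation : Torus n → C(Torus n, Torus n)) :=
  ContinuousMap.continuous_of_continuous_uncurry _ (by
    change Continuous fun p : Torus n × Torus n => p.2 + p.1
    fun_prop)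

lemma torusFourierCoeff_translation (u : Torus n → ℝ) (k : Fin n → ℤ) (y : Fin n → ℝ) :
    torusFourierCoeff (fun x => u (x + Torus.mk y)) k =
      Complex.exp (Complex.I * phase k y) * torusFourierCoeff u k := by
  rw [torusFourierCoeff_def, torusFourierCoeff_def, ← integral_const_mul,
    ← integral_add_right_eq_self (fun x => Complex.exp (Complex.I * phase k y) *
      UnitAddTorus.mFourier (-k) x • (u x : ℂ)) (Torus.mk y)]
  refine integral_congr_ae (ae_of_all _ fun x => ?_)
  have h : phase (-k) y = -phase k y := by simp [phase]
  have hE : Complex.exp (Complex.I * phase k y) *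
      Complex.exp (Complex.I * ((-phase k y : ℝ) : ℂ)) = 1 := by
    rw [← Complex.exp_add]
    simp
  simp only [smul_eq_mul]
  rw [mFourier_mul_arg, mFourier_mk, h]
  linear_combination -(UnitAddTorus.mFourier (-k) x * (u (x + Torus.mk y) : ℂ)) * hE

/-- The Hilbert space of square integrable functions with the action of translations. -/
def l2Rep (n : ℕ) : TorusRep n (L2 n) where
  shift y := LinearMap.mkContinuous
    { toFun := fun u => Lp.compMeasurePreserving (translation (Torus.mk y))
        (measurePreserving_translation _) u
      map_add' := fun u v => map_add _ u v
      map_smul' := fun c u => by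
        refine Lp.ext ?_
        filter_upwards [Lp.coeFn_compMeasurePreserving (c • u)
            (measurePreserving_translation (Torus.mk y)),
          Lp.coeFn_smul c (Lp.compMeasurePreserving (translation (Torus.mk y))
            (measurePreserving_translation _) u),
          Lp.coeFn_compMeasurePreserving u (measurePreserving_translation (Torus.mk y)),
          (measurePreserving_translation (Torus.mk y)).quasiMeasurePreserving.ae
            (Lp.coeFn_smul c u)] with x h1 h2 h3 h4
        rw [h1, RingHom.id_apply, h2, Pi.smul_apply, h3, Function.comp_apply, h4]
        rfl } 1 fun u => by
      rw [one_mul]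
      exact (Lp.norm_compMeasurePreserving u _).le
  coeff := l2Coeff
  norm_shift_le y u := (Lp.norm_compMeasurePreserving u _).le
  continuous_shift u :=
    Continuous.compMeasurePreservingLp (f := fun _ => u)
      (g := fun y => translation (Torus.mk y)) continuous_const
      (continuous_translation.comp continuous_torusMk)
      (fun y => measurePreserving_translation _) (by simp)
  coeff_shift k y u := by
    rw [l2Coeff_apply, l2Coeff_apply, ← torusFourierCoeff_translation]
    exact torusFourierCoeff_congr
      (Lp.coeFn_compMeasurePreserving u (measurePreserving_translation _)) k
  eq_zero_of_coeff u h := eq_zero_of_l2Coeff h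

/-- The inclusion of continuous into square integrable functions. -/
def toL2 (n : ℕ) : C(Torus n, ℝ) →L[ℝ] L2 n := ContinuousMap.toLp 2 (Torus.measure n) ℝ

lemma toL2_ae (u : C(Torus n, ℝ)) : toL2 n u =ᵐ[Torus.measure n] u :=
  ContinuousMap.coeFn_toLp _ u

lemma toL2_injective : Function.Injective (toL2 n) :=
  ContinuousMap.toLp_injective _

lemma toL2_denseRange : DenseRange (toL2 n) :=
  ContinuousMap.toLp_denseRange ℝ _ ℝ (by simp)

/-- The space of continuous functions with the action of translations. -/
def contRep (n : ℕ) : TorusRep n C(Torus n, ℝ) where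
  shift y := LinearMap.mkContinuous
    { toFun := fun u => u.comp (translation (Torus.mk y))
      map_add' := fun _ _ => rfl
      map_smul' := fun _ _ => rfl } 1 fun u => by
      rw [one_mul]
      exact (ContinuousMap.norm_le _ (norm_nonneg _)).2 fun x => u.norm_coe_le_norm _
  coeff k := (l2Coeff k).comp (toL2 n)
  norm_shift_le y u := (ContinuousMap.norm_le _ (norm_nonneg _)).2 fun x => u.norm_coe_le_norm _
  continuous_shift u := ContinuousMap.continuous_of_continuous_uncurry _
    (u.continuous.comp (by
      change Continuous fun p : (Fin n → ℝ) × Torus n => p.2 + Torus.mk p.1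
      exact continuous_snd.add (continuous_torusMk.comp continuous_fst)))
  coeff_shift k y u := by
    rw [ContinuousLinearMap.comp_apply, ContinuousLinearMap.comp_apply, l2Coeff_apply,
      l2Coeff_apply, torusFourierCoeff_congr (toL2_ae u), ← torusFourierCoeff_translation]
    exact torusFourierCoeff_congr (toL2_ae _) k
  eq_zero_of_coeff u h := toL2_injective ((eq_zero_of_l2Coeff (u := toL2 n u) h).trans (map_zero _).symm)

lemma contRep_shift_apply (y : Fin n → ℝ) (u : C(Torus n, ℝ)) (x : Torus n) :
    (contRep n).shift y u x = u (x + Torus.mk y) := rfl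

lemma contRep_coeff (k : Fin n → ℤ) (u : C(Torus n, ℝ)) :
    (contRep n).coeff k u = torusFourierCoeff u k := by
  rw [← torusFourierCoeff_congr (toL2_ae u), ← l2Coeff_apply]
  rfl

lemma l2Rep_coeff (k : Fin n → ℤ) (u : L2 n) :
    (l2Rep n).coeff k u = torusFourierCoeff u k := l2Coeff_apply u k

lemma l2Rep_coeff_toL2 (k : Fin n → ℤ) (u : C(Torus n, ℝ)) :
    (l2Rep n).coeff k (toL2 n u) = (contRep n).coeff k u := rfl

lemma toL2_poisson {r : ℝ} (hr : 0 ≤ r) (u : C(Torus n, ℝ)) :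
    toL2 n ((contRep n).poisson r u) = (l2Rep n).poisson r (toL2 n u) :=
  (l2Rep n).ext_coeff fun k => by
    rw [l2Rep_coeff_toL2, TorusRep.coeff_poisson _ hr, TorusRep.coeff_poisson _ hr,
      l2Rep_coeff_toL2]

lemma summable_pi_prod {a : ℤ → ℝ} (ha : Summable a) (h0 : ∀ i, 0 ≤ a i) :
    Summable fun k : Fin n → ℤ => ∏ i, a (k i) := by
  classical
  refine summable_of_sum_le (c := ∏ _i : Fin n, ∑' j, a j)
    (fun k => Finset.prod_nonneg fun i _ => h0 _) fun s => ?_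
  have hsub : s ⊆ Fintype.piFinset fun i => s.image fun k => k i := fun k hk =>
    Fintype.mem_piFinset.2 fun i => Finset.mem_image_of_mem _ hk
  refine (Finset.sum_le_sum_of_subset_of_nonneg hsub fun k _ _ =>
    Finset.prod_nonneg fun i _ => h0 _).trans ?_
  rw [← Finset.prod_univ_sum]
  exact Finset.prod_le_prod (fun i _ => Finset.sum_nonneg fun j _ => h0 j) fun i _ =>
    ha.sum_le_tsum _ fun j _ => h0 j

lemma summable_exp_neg_abs {c : ℝ} (hc : 0 < c) : Summable fun j : ℤ => Real.exp (-(c * |(j : ℝ)|)) := by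
  have h : Summable fun m : ℕ => Real.exp (-(c * m)) := by
    have := Real.summable_exp_nat_mul_iff (a := -c)
    refine (this.2 (by linarith)).congr fun m => ?_
    ring_nf
  refine Summable.of_nat_of_neg ?_ ?_
  · simpa using h
  · simpa using h

lemma summable_exp_neg_halfLaplaceSymbol {r : ℝ} (hr : 0 < r) :
    Summable fun k : Fin n → ℤ => Real.exp (-(halfLaplaceSymbol k * r)) := by
  have hc : 0 < 2 * Real.pi * r / (n + 1) := by positivity
  refine (summable_pi_prod (n := n) (summable_exp_neg_abs hc) fun j =>
    Real.exp_nonneg _).of_nonneg_of_le (fun k => Real.exp_nonneg _) fun k => ?_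
  rw [← Real.exp_sum, Real.exp_le_exp, Finset.sum_neg_distrib, neg_le_neg_iff, halfLaplaceSymbol]
  have h1 : ∀ i ∈ Finset.univ, 2 * Real.pi * r / (n + 1) * |(k i : ℝ)| ≤
      2 * Real.pi * r / (n + 1) * √(∑ i, (k i : ℝ) ^ 2) := by
    intro i _
    refine mul_le_mul_of_nonneg_left ?_ hc.le
    rw [← Real.sqrt_sq_eq_abs]
    exact Real.sqrt_le_sqrt (Finset.single_le_sum (f := fun i => (k i : ℝ) ^ 2)
      (fun i _ => sq_nonneg _) (Finset.mem_univ i))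
  refine (Finset.sum_le_sum h1).trans ?_
  rw [Finset.sum_const, Finset.card_univ, Fintype.card_fin, nsmul_eq_mul]
  have h2 : (n : ℝ) / (n + 1) ≤ 1 := by
    rw [div_le_one (by positivity)]
    linarith
  have h3 : 0 ≤ 2 * Real.pi * r * √(∑ i, (k i : ℝ) ^ 2) := by positivity
  calc (n : ℝ) * (2 * Real.pi * r / (n + 1) * √(∑ i, (k i : ℝ) ^ 2))
      = n / (n + 1) * (2 * Real.pi * r * √(∑ i, (k i : ℝ) ^ 2)) := by ring
    _ ≤ 1 * (2 * Real.pi * r * √(∑ i, (k i : ℝ) ^ 2)) := mul_le_mul_of_nonneg_right h2 h3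
    _ = _ := by ring

/-- The Poisson semigroup maps `L²` boundedly to continuous functions. -/
lemma norm_contRep_poisson_le {r : ℝ} (hr : 0 < r) (u : C(Torus n, ℝ)) :
    ‖(contRep n).poisson r u‖ ≤
      (∑' k : Fin n → ℤ, Real.exp (-(halfLaplaceSymbol k * r))) * ‖toL2 n u‖ := by
  have hs := summable_exp_neg_halfLaplaceSymbol (n := n) hr
  have hs' := hs.mul_right ‖toL2 n u‖
  rw [← tsum_mul_right, ContinuousMap.norm_le _ (tsum_nonneg fun k => by positivity)]
  intro x
  set v : C(Torus n, ℂ) := ⟨fun x => ((contRep n).poisson r u x : ℂ), by fun_prop⟩ with hv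
  have hco : ∀ k, ‖UnitAddTorus.mFourierCoeff v k‖ ≤
      Real.exp (-(halfLaplaceSymbol k * r)) * ‖toL2 n u‖ := by
    intro k
    have h1 : UnitAddTorus.mFourierCoeff v k = (contRep n).coeff k ((contRep n).poisson r u) :=
      (contRep_coeff k _).symm
    rw [h1, TorusRep.coeff_poisson _ hr.le, norm_mul, Complex.norm_real,
      Real.norm_of_nonneg (Real.exp_nonneg _)]
    exact mul_le_mul_of_nonneg_left (norm_l2Coeff_le _ k) (Real.exp_nonneg _)
  have hsum := UnitAddTorus.hasSum_mFourier_series_apply_of_summable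
    (Summable.of_norm_bounded hs' hco) x
  have h2 : ‖(contRep n).poisson r u x‖ = ‖v x‖ := by simp [hv]
  rw [h2]
  refine hsum.norm_le_of_bounded hs'.hasSum fun k => ?_
  rw [norm_smul]
  refine (mul_le_of_le_one_right (norm_nonneg _) ?_).trans (hco k)
  exact ((UnitAddTorus.mFourier k).norm_coe_le_norm x).trans UnitAddTorus.mFourier_norm.le

/-- The Poisson semigroup at positive times, as operators from square integrable to continuous
functions. -/
def smoothing (r : ℝ) : L2 n →L[ℝ] C(Torus n, ℝ) :=
  LinearMap.extendOfNorm ((contRep n).poisson r).toLinearMap (toL2 n).toLinearMap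

lemma smoothing_toL2 {r : ℝ} (hr : 0 < r) (u : C(Torus n, ℝ)) :
    smoothing r (toL2 n u) = (contRep n).poisson r u :=
  LinearMap.extendOfNorm_eq (f := ((contRep n).poisson r).toLinearMap)
    (e := (toL2 n).toLinearMap) toL2_denseRange ⟨_, norm_contRep_poisson_le hr⟩ u

lemma toL2_smoothing {r : ℝ} (hr : 0 < r) (f : L2 n) :
    toL2 n (smoothing r f) = (l2Rep n).poisson r f := by
  refine toL2_denseRange.induction_on f
    (isClosed_eq ((toL2 n).continuous.comp (smoothing r).continuous)
      ((l2Rep n).poisson r).continuous) fun u => ?_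
  rw [smoothing_toL2 hr, toL2_poisson hr.le]

lemma smoothing_add {r s : ℝ} (hr : 0 ≤ r) (hs : 0 < s) (f : L2 n) :
    smoothing (r + s) f = (contRep n).poisson r (smoothing s f) := by
  refine toL2_injective ?_
  rw [toL2_smoothing (by linarith), toL2_poisson hr, toL2_smoothing hs,
    TorusRep.poisson_add _ hr hs.le]

lemma continuousOn_smoothing :
    ContinuousOn (fun q : ℝ × L2 n => smoothing q.1 q.2) (Ioi 0 ×ˢ univ) := by
  intro p hp
  have hr : 0 < p.1 / 2 := half_pos hp.1
  have h0 : Continuous fun q : ℝ × L2 n => smoothing (p.1 / 2) q.2 :=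
    (smoothing (p.1 / 2)).continuous.comp continuous_snd
  have h1 : Continuous fun q : ℝ × L2 n =>
      (contRep n).poisson (q.1 - p.1 / 2) (smoothing (p.1 / 2) q.2) :=
    (contRep n).continuous_poisson.comp
      (f := fun q : ℝ × L2 n => (q.1 - p.1 / 2, smoothing (p.1 / 2) q.2))
      ((continuous_fst.sub continuous_const).prodMk h0)
  have hev : ∀ᶠ q : ℝ × L2 n in 𝓝 p, p.1 / 2 < q.1 :=
    continuous_fst.continuousAt.eventually_const_lt (half_lt_self hp.1)
  refine (h1.continuousAt.congr ?_).continuousWithinAt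
  filter_upwards [hev] with q hq
  rw [← smoothing_add (by linarith) hr, sub_add_cancel]

/-- The truncation of real numbers to `[-M, M]`. -/
def clip (M y : ℝ) : ℝ := max (-M) (min M y)

lemma lipschitzWith_clip (M : ℝ) : LipschitzWith 1 (clip M) :=
  (LipschitzWith.id.const_min M).const_max (-M)

lemma clip_eq_self {M y : ℝ} (h : |y| ≤ M) : clip M y = y := by
  rw [clip, min_eq_right (abs_le.1 h).2, max_eq_right (abs_le.1 h).1]

lemma abs_clip_le {M : ℝ} (hM : 0 ≤ M) (y : ℝ) : |clip M y| ≤ M :=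
  abs_le.2 ⟨le_max_left _ _, max_le (by linarith) (min_le_left _ _)⟩

/-- The smoothing operators do not increase the supremum norm. -/
lemma norm_smoothing_le {r M : ℝ} (hr : 0 < r) (hM : 0 ≤ M) {f : L2 n}
    (hf : ∀ᵐ x ∂Torus.measure n, |f x| ≤ M) : ‖smoothing r f‖ ≤ M := by
  have hL := lipschitzWith_clip M
  have h0 : clip M 0 = 0 := clip_eq_self (by simpa using hM)
  have h1 : ∀ g : L2 n, ‖smoothing r (hL.compLp h0 g)‖ ≤ M := by
    intro g
    refine toL2_denseRange.induction_on g (isClosed_le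
      ((smoothing r).continuous.comp (LipschitzWith.continuous_compLp hL h0)).norm
        continuous_const) fun u => ?_
    have h2 : hL.compLp h0 (toL2 n u) =
        toL2 n ⟨fun x => clip M (u x), hL.continuous.comp u.continuous⟩ := by
      refine Lp.ext ?_
      filter_upwards [LipschitzWith.coeFn_compLp hL h0 (toL2 n u), toL2_ae u,
        toL2_ae ⟨fun x => clip M (u x), hL.continuous.comp u.continuous⟩] with x h3 h4 h5
      rw [h3, h5, Function.comp_apply, h4]
      rfl
    rw [h2, smoothing_toL2 hr]
    exact (TorusRep.norm_poisson_le _ _ _).trans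
      ((ContinuousMap.norm_le _ hM).2 fun x => abs_clip_le hM _)
  have h2 : hL.compLp h0 f = f := by
    refine Lp.ext ?_
    filter_upwards [LipschitzWith.coeFn_compLp hL h0 f, hf] with x h3 h4
    rw [h3, Function.comp_apply, clip_eq_self h4]
  rw [← h2]
  exact h1 f

section Nonlinearity

variable {φ : Torus n → ℝ → ℝ}

lemma IsPinningForce.continuous (hφ : IsPinningForce φ) :
    Continuous fun p : Torus n × ℝ => φ p.1 p.2 := by
  obtain ⟨K, hK⟩ := hφ.lipschitz
  exact hK.continuous

lemma IsPinningForce.exists_bound (hφ : IsPinningForce φ) (F : ℝ) :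
    ∃ M, 0 ≤ M ∧ ∀ x y, |φ x y + F| ≤ M := by
  obtain ⟨M, hM⟩ := (isCompact_univ.prod isCompact_Icc).exists_bound_of_continuousOn
    (s := (univ : Set (Torus n)) ×ˢ Icc (0 : ℝ) 1)
    (hφ.continuous.add (continuous_const (y := F))).continuousOn
  refine ⟨max M 0, le_max_right _ _, fun x y => ?_⟩
  have hper : Function.Periodic (φ x) 1 := hφ.periodic x
  have h1 : φ x y = φ x (Int.fract y) := by
    have := hper.sub_int_mul_eq ⌊y⌋ (x := y)
    rw [mul_one] at this
    exact this.symm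
  rw [h1]
  exact (hM (x, Int.fract y) ⟨mem_univ _, Int.fract_nonneg y, (Int.fract_lt_one y).le⟩).trans
    (le_max_left _ _)

/-- The right-hand side `φ(x, u(x)) + F` as a map on continuous functions. -/
def contForce (hφ : IsPinningForce φ) (F : ℝ) (u : C(Torus n, ℝ)) : C(Torus n, ℝ) :=
  ⟨fun x => φ x (u x) + F,
    (hφ.continuous.comp (continuous_id.prodMk u.continuous)).add continuous_const⟩

/-- The right-hand side `φ(x, u(x)) + F` as a map on square integrable functions. -/
def l2Force (hφ : IsPinningForce φ) (F : ℝ) (u : L2 n) : L2 n :=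
  MemLp.toLp (fun x => φ x (u x) + F) (MemLp.of_bound
    ((hφ.continuous.comp_aestronglyMeasurable
      (aestronglyMeasurable_id.prodMk (Lp.aestronglyMeasurable u))).add
        aestronglyMeasurable_const)
    (hφ.exists_bound F).choose
    (ae_of_all _ fun x => (hφ.exists_bound F).choose_spec.2 x (u x)))

lemma l2Force_ae (hφ : IsPinningForce φ) (F : ℝ) (u : L2 n) :
    l2Force hφ F u =ᵐ[Torus.measure n] fun x => φ x (u x) + F :=
  MemLp.coeFn_toLp _

lemma l2Force_toL2 (hφ : IsPinningForce φ) (F : ℝ) (u : C(Torus n, ℝ)) :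
    l2Force hφ F (toL2 n u) = toL2 n (contForce hφ F u) := by
  refine Lp.ext ?_
  filter_upwards [l2Force_ae hφ F (toL2 n u), toL2_ae u, toL2_ae (contForce hφ F u)]
    with x h1 h2 h3
  rw [h1, h2, h3]
  rfl

lemma abs_sub_le_of_lipschitz {K : NNReal}
    (hK : LipschitzWith K fun p : Torus n × ℝ => φ p.1 p.2) (x : Torus n) (a b : ℝ) :
    |φ x a - φ x b| ≤ K * |a - b| := by
  have h := hK.dist_le_mul (x, a) (x, b)
  rwa [Prod.dist_eq, dist_self, max_eq_right dist_nonneg, Real.dist_eq, Real.dist_eq] at h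

lemma lipschitzWith_contForce (hφ : IsPinningForce φ) (F : ℝ) {K : NNReal}
    (hK : LipschitzWith K fun p : Torus n × ℝ => φ p.1 p.2) :
    LipschitzWith K (contForce hφ F) := by
  refine LipschitzWith.of_dist_le_mul fun u v => ?_
  rw [dist_eq_norm, ContinuousMap.norm_le _ (by positivity)]
  intro x
  have h1 : (contForce hφ F u - contForce hφ F v) x = φ x (u x) - φ x (v x) := by
    simp [contForce]
  rw [h1, Real.norm_eq_abs]
  refine (abs_sub_le_of_lipschitz hK x _ _).trans (mul_le_mul_of_nonneg_left ?_ K.coe_nonneg)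
  rw [← Real.dist_eq]
  exact ContinuousMap.dist_apply_le_dist x

lemma lipschitzWith_l2Force (hφ : IsPinningForce φ) (F : ℝ) {K : NNReal}
    (hK : LipschitzWith K fun p : Torus n × ℝ => φ p.1 p.2) :
    LipschitzWith K (l2Force hφ F) := by
  refine LipschitzWith.of_dist_le_mul fun u v => ?_
  rw [dist_eq_norm, dist_eq_norm]
  refine Lp.norm_le_mul_norm_of_ae_le_mul ?_
  filter_upwards [l2Force_ae hφ F u, l2Force_ae hφ F v,
    Lp.coeFn_sub (l2Force hφ F u) (l2Force hφ F v), Lp.coeFn_sub u v] with x h1 h2 h3 h4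
  rw [h3, h4, Pi.sub_apply, Pi.sub_apply, h1, h2, add_sub_add_right_eq_sub]
  exact abs_sub_le_of_lipschitz hK x _ _

lemma norm_contForce_le {hφ : IsPinningForce φ} {F M : ℝ} (hM0 : 0 ≤ M)
    (hM : ∀ x y, |φ x y + F| ≤ M) (u : C(Torus n, ℝ)) : ‖contForce hφ F u‖ ≤ M :=
  (ContinuousMap.norm_le _ hM0).2 fun x => hM x (u x)

lemma norm_torusMk_single_le (j : Fin n) (h : ℝ) :
    ‖(Torus.mk (Pi.single j h) : Torus n)‖ ≤ |h| := by
  refine (pi_norm_le_iff_of_nonneg (abs_nonneg h)).2 fun i => ?_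
  refine (QuotientAddGroup.norm_mk_le_norm).trans ?_
  rcases eq_or_ne i j with rfl | hij
  · simp
  · simp [hij]

lemma isSpaceHolder_contForce (hφ : IsPinningForce φ) (F : ℝ) {a : ℝ}
    {g : ℝ → C(Torus n, ℝ)} (hg : (contRep n).IsSpaceHolder a g) :
    (contRep n).IsSpaceHolder a fun t => contForce hφ F (g t) := by
  intro R
  obtain ⟨K, hK⟩ := hφ.lipschitz
  obtain ⟨M, hM0, hM⟩ := hφ.exists_bound F
  obtain ⟨H, hH0, hH⟩ := hg R
  refine ⟨K * (1 + H) + 2 * M, by positivity, fun s hs j h => ?_⟩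
  have hsq := Real.sq_sqrt (abs_nonneg h)
  have hs0 := Real.sqrt_nonneg |h|
  rcases le_total 1 (√|h|) with h1 | h1
  · refine ((contRep n).norm_shift_sub_le _ _).trans ?_
    have h2 := norm_contForce_le (hφ := hφ) hM0 hM (g s)
    have h3 : 0 ≤ K * (1 + H) * √|h| := by positivity
    have h4 : M * 1 ≤ M * √|h| := mul_le_mul_of_nonneg_left h1 hM0
    linarith
  · have h2 : |h| ≤ √|h| := by nlinarith
    have h3 : ‖(contRep n).shift (Pi.single j h) (contForce hφ F (g s)) - contForce hφ F (g s)‖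
        ≤ K * ((1 + H) * √|h|) := by
      rw [ContinuousMap.norm_le _ (by positivity)]
      intro x
      have h4 : ((contRep n).shift (Pi.single j h) (contForce hφ F (g s)) -
          contForce hφ F (g s)) x = φ (x + Torus.mk (Pi.single j h))
            (g s (x + Torus.mk (Pi.single j h))) - φ x (g s x) := by
        rw [ContinuousMap.sub_apply, contRep_shift_apply]
        simp [contForce]
      rw [h4, ← dist_eq_norm]
      refine (hK.dist_le_mul (x + Torus.mk (Pi.single j h),
        g s (x + Torus.mk (Pi.single j h))) (x, g s x)).trans
        (mul_le_mul_of_nonneg_left ?_ K.coe_nonneg)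
      rw [Prod.dist_eq]
      refine max_le ?_ ?_
      · rw [dist_self_add_left]
        have := norm_torusMk_single_le j h
        nlinarith [mul_nonneg hH0 hs0]
      · have h5 := (((contRep n).shift (Pi.single j h) (g s) - g s).norm_coe_le_norm x).trans
          (hH s hs j h)
        rw [ContinuousMap.sub_apply, contRep_shift_apply, ← dist_eq_norm] at h5
        linarith
    nlinarith [mul_nonneg hM0 hs0]

end Nonlinearity

section Regularity

variable {φ : Torus n → ℝ → ℝ}

lemma glue_multiplier {m : (Fin n → ℤ) → ℂ} {g : ℝ → C(Torus n, ℝ)}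
    (h : ∀ a, 0 < a → ∃ v : ℝ → C(Torus n, ℝ), ContinuousOn v (Ioi a) ∧
      ∀ t, a < t → ∀ k, (contRep n).coeff k (v t) = m k * (contRep n).coeff k (g t)) :
    ∃ v : ℝ → C(Torus n, ℝ), ContinuousOn v (Ioi 0) ∧
      ∀ t, 0 < t → ∀ k, (contRep n).coeff k (v t) = m k * (contRep n).coeff k (g t) := by
  choose v hvc hv using h
  refine ⟨fun t => if ht : 0 < t then v (t / 2) (half_pos ht) t else 0, fun t ht => ?_,
    fun t ht k => ?_⟩
  · have ht' : (0 : ℝ) < t := ht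
    refine (((hvc (t / 2) (half_pos ht')).continuousAt
      (Ioi_mem_nhds (half_lt_self ht'))).congr ?_).continuousWithinAt
    filter_upwards [Ioi_mem_nhds (half_lt_self ht')] with s hs
    have hs0 : 0 < s := (half_pos ht').trans hs
    rw [dif_pos hs0]
    exact (contRep n).ext_coeff fun k => by
      rw [hv _ _ s hs, hv _ _ s (half_lt_self hs0)]
  · simp only [dif_pos ht]
    exact hv _ _ t (half_lt_self ht) k

/-- Mild solutions with values in the continuous functions are classical. -/
theorem isClassicalSolutionOn_of_isMildFrom (hφ : IsPinningForce φ) (F : ℝ)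
    {g : ℝ → C(Torus n, ℝ)} (hg : ContinuousOn g (Ioi 0))
    (hm : ∀ a, 0 < a → (contRep n).IsMildFrom a (fun t => contForce hφ F (g t)) g) :
    IsClassicalSolutionOn φ F (Ioi 0) fun t => g t := by
  obtain ⟨K, hK⟩ := hφ.lipschitz
  set f : ℝ → C(Torus n, ℝ) := fun t => contForce hφ F (g t) with hfdef
  have hf : ContinuousOn f (Ioi 0) := (lipschitzWith_contForce hφ F hK).continuous.comp_continuousOn hg
  have hfa : ∀ a, 0 < a → ContinuousOn f (Ici a) := fun a ha =>
    hf.mono (Ici_subset_Ioi.2 ha)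
  have hH : ∀ a, 0 < a → (contRep n).IsSpaceHolder a f := fun a ha =>
    isSpaceHolder_contForce hφ F (TorusRep.IsMildFrom.isSpaceHolder _ (hfa _ (half_pos ha))
      (hm _ (half_pos ha)) (half_lt_self ha))
  obtain ⟨v, hvc, hv⟩ := glue_multiplier (g := g) fun a ha =>
    TorusRep.IsMildFrom.exists_multiplier _ (hfa a ha) (hm a ha) (hH a ha)
      (generates_timeWeight n) symb_timeWeight_zero hasRootMoment_timeWeight
  have hw := fun j : Fin n => glue_multiplier (g := g) fun a ha =>
    TorusRep.IsMildFrom.exists_multiplier _ (hfa a ha) (hm a ha) (hH a ha)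
      (generates_spaceWeight j) (symb_spaceWeight_zero j) (hasRootMoment_spaceWeight j)
  choose w hwc hw using hw
  have hd : ∀ t ∈ Ioi (0 : ℝ), HasDerivAt g (-v t + f t) t := fun t ht =>
    TorusRep.IsMildFrom.hasDerivAt _ (hfa (t / 2) (half_pos ht)) (hm _ (half_pos ht))
      (hvc.mono (Ioi_subset_Ioi (half_pos ht).le))
      (fun s hs => hv s ((half_pos ht).trans hs)) (half_lt_self ht)
  have hC1 := (contRep n).contDiffOn_shift isOpen_Ioi hd (hvc.neg.add hf) hwc
    fun t ht j k => hw j t ht k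
  refine ⟨?_, fun t x => v t x, ?_, fun t ht => ⟨⟨(g t).continuous, (v t).continuous, fun k => ?_⟩,
    fun x => ?_⟩⟩
  · refine ((ContinuousMap.evalCLM ℝ (0 : Torus n)).contDiff.comp_contDiffOn hC1).congr
      fun p _ => ?_
    simp [contRep_shift_apply]
  · exact ContinuousOn.eval (hvc.comp continuousOn_fst fun p hp => hp.1) continuousOn_snd
  · rw [← contRep_coeff, ← contRep_coeff]
    exact hv t ht k
  · have h1 := ((ContinuousMap.evalCLM ℝ x).hasFDerivAt.comp_hasDerivAt t (hd t ht)).deriv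
    have h2 : deriv (fun s => g s x) t = (-v t + f t) x := h1
    rw [h2, add_assoc]
    rfl

/-- Mild solutions with values in `L²` have a representative which is a mild solution with values
in the continuous functions, at positive times. -/
theorem exists_continuous_representative (hφ : IsPinningForce φ) (F : ℝ) {g : ℝ → L2 n}
    (hg : ContinuousOn g (Ici 0))
    (hm : (l2Rep n).IsMildFrom 0 (fun t => l2Force hφ F (g t)) g) :
    ∃ G : ℝ → C(Torus n, ℝ), ContinuousOn G (Ioi 0) ∧ (∀ t, 0 < t → toL2 n (G t) = g t) ∧
      ∀ a, 0 < a → (contRep n).IsMildFrom a (fun t => contForce hφ F (G t)) G := by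
  obtain ⟨K, hK⟩ := hφ.lipschitz
  obtain ⟨M, hM0, hM⟩ := hφ.exists_bound F
  set f : ℝ → L2 n := fun t => l2Force hφ F (g t) with hfdef
  have hf : ContinuousOn f (Ici 0) := (lipschitzWith_l2Force hφ F hK).continuous.comp_continuousOn hg
  have hker : IsConvolutionKernel 0 fun r s => (smoothing r (f s) : C(Torus n, ℝ)) :=
    { continuousOn := continuousOn_smoothing.comp (f := fun q : ℝ × ℝ => (q.1, f q.2))
        (continuousOn_fst.prodMk (hf.comp continuousOn_snd fun q hq => hq.2))
        fun q hq => ⟨hq.1, mem_univ _⟩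
      bound := fun R => ⟨fun _ => M, integrableOn_const measure_Ioc_lt_top.ne, fun r hr s _ =>
        norm_smoothing_le hr.1 hM0 (by
          filter_upwards [l2Force_ae hφ F (g s)] with x hx
          rw [hx]
          exact hM _ _)⟩ }
  set G : ℝ → C(Torus n, ℝ) := fun t =>
    smoothing t (g 0) + ∫ s in (0 : ℝ)..t, smoothing (t - s) (f s) with hG
  have hGc : ContinuousOn G (Ioi 0) :=
    (continuousOn_smoothing.comp (f := fun t : ℝ => (t, g 0))
      (continuousOn_id.prodMk continuousOn_const) fun t ht => ⟨ht, mem_univ _⟩).add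
      (hker.continuousOn_integral.mono Ioi_subset_Ici_self)
  have hGg : ∀ t, 0 < t → toL2 n (G t) = g t := by
    intro t ht
    rw [hm t ht.le, hG, map_add, toL2_smoothing ht, sub_zero,
      ← ContinuousLinearMap.intervalIntegral_comp_comm _ (hker.intervalIntegrable ht.le)]
    congr 1
    refine intervalIntegral.integral_congr_ae ?_
    filter_upwards [compl_mem_ae_iff.2 (measure_singleton t)] with s hs hs2
    rw [uIoc_of_le ht.le] at hs2
    exact toL2_smoothing (sub_pos.2 (lt_of_le_of_ne hs2.2 hs)) _
  refine ⟨G, hGc, hGg, fun a ha t hat => ?_⟩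
  have hfa : ContinuousOn f (Ici a) := hf.mono (Ici_subset_Ici.2 ha.le)
  have hfG : ContinuousOn (fun t => contForce hφ F (G t)) (Ici a) :=
    ((lipschitzWith_contForce hφ F hK).continuous.comp_continuousOn hGc).mono
      (Ici_subset_Ioi.2 ha)
  refine (contRep n).ext_coeff fun k => ?_
  rw [(contRep n).coeff_variation_of_constants hfG hat, ← l2Rep_coeff_toL2, ← l2Rep_coeff_toL2,
    hGg t (ha.trans_le hat), hGg a ha,
    TorusRep.IsMildFrom.restart _ hf hm ha.le t hat,
    (l2Rep n).coeff_variation_of_constants hfa hat]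
  congr 1
  refine intervalIntegral.integral_congr fun s hs => ?_
  rw [uIcc_of_le hat] at hs
  rw [← l2Rep_coeff_toL2, ← l2Force_toL2, hGg s (ha.trans_le hs.1)]

end Regularity

section Comparison

/-- The Poisson semigroup does not exceed an upper bound. -/
lemma contRep_poisson_apply_le {u : C(Torus n, ℝ)} {c : ℝ} (h : ∀ x, u x ≤ c) (r : ℝ)
    (x : Torus n) : (contRep n).poisson r u x ≤ c := by
  have h1 := (contRep n).integrable_avg (poissonWeight n) r u
  have h2 : (contRep n).poisson r u x = ∫ p, (ContinuousMap.evalCLM ℝ x)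
      ((poissonWeight n).toFun p • (contRep n).shift (TorusRep.disp r p) u) ∂gaussPair n :=
    ((ContinuousMap.evalCLM ℝ x).integral_comp_comm h1).symm
  have h3 : c = ∫ _, c ∂gaussPair n := by simp
  rw [h2, h3]
  refine integral_mono ((ContinuousMap.evalCLM ℝ x).integrable_comp h1) (integrable_const c)
    fun p => ?_
  simpa [poissonWeight, contRep_shift_apply] using h (x + Torus.mk (TorusRep.disp r p))

lemma poisson_sub_eq_integral {u v : C(Torus n, ℝ)}
    (h : ∀ k, (contRep n).coeff k v = (halfLaplaceSymbol k : ℂ) * (contRep n).coeff k u) {t : ℝ}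
    (ht : 0 ≤ t) : u - (contRep n).poisson t u = ∫ s in (0 : ℝ)..t, (contRep n).poisson s v := by
  refine (contRep n).ext_coeff fun k => ?_
  have hi : IntervalIntegrable (fun s => (contRep n).poisson s v) volume 0 t :=
    ((contRep n).continuous_avg _ v).intervalIntegrable _ _
  rw [← ContinuousLinearMap.intervalIntegral_comp_comm _ hi, map_sub,
    TorusRep.coeff_poisson _ ht]
  set l := halfLaplaceSymbol k with hl
  have hc : ∀ s ∈ uIcc 0 t, (contRep n).coeff k ((contRep n).poisson s v) =
      ((l * Real.exp (-(l * s)) : ℝ) : ℂ) * (contRep n).coeff k u := by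
    intro s hs
    rw [uIcc_of_le ht] at hs
    rw [TorusRep.coeff_poisson _ hs.1, h, ← hl]
    push_cast
    ring
  have hd : ∀ s ∈ uIcc 0 t, HasDerivAt (fun s : ℝ => -Real.exp (-(l * s)))
      (l * Real.exp (-(l * s))) s := by
    intro s _
    refine ((((hasDerivAt_id s).const_mul l).neg).exp.neg).congr_deriv ?_
    simp only [id, Pi.neg_apply]
    ring
  rw [intervalIntegral.integral_congr hc, intervalIntegral.integral_mul_const,
    intervalIntegral.integral_ofReal, intervalIntegral.integral_eq_sub_of_hasDerivAt hd
      (Continuous.intervalIntegrable (by fun_prop) _ _)]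
  push_cast
  simp
  ring

/-- The half Laplacian is nonnegative at a maximum. -/
lemma nonneg_of_isMax {u v : C(Torus n, ℝ)}
    (h : ∀ k, (contRep n).coeff k v = (halfLaplaceSymbol k : ℂ) * (contRep n).coeff k u)
    {x : Torus n} (hx : ∀ y, u y ≤ u x) : 0 ≤ v x := by
  by_contra hneg
  push Not at hneg
  have hcont : Continuous fun s => (contRep n).poisson s v x :=
    (ContinuousMap.evalCLM ℝ x).continuous.comp ((contRep n).continuous_avg _ v)
  have h0 : (contRep n).poisson 0 v x < 0 := by rwa [TorusRep.poisson_zero]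
  obtain ⟨δ, hδ, hball⟩ := Metric.eventually_nhds_iff_ball.1
    (hcont.continuousAt.eventually_lt_const h0)
  have ht : 0 < δ / 2 := half_pos hδ
  have h1 := congrArg (fun w : C(Torus n, ℝ) => w x) (poisson_sub_eq_integral h ht.le)
  have h2 : (∫ s in (0 : ℝ)..(δ / 2), (contRep n).poisson s v) x =
      ∫ s in (0 : ℝ)..(δ / 2), (contRep n).poisson s v x :=
    ((ContinuousMap.evalCLM ℝ x).intervalIntegral_comp_comm
      (((contRep n).continuous_avg _ v).intervalIntegrable _ _)).symm
  simp only [ContinuousMap.sub_apply] at h1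
  rw [h2] at h1
  have h3 : 0 ≤ ∫ s in (0 : ℝ)..(δ / 2), (contRep n).poisson s v x := by
    rw [← h1]
    linarith [contRep_poisson_apply_le hx (δ / 2) x]
  have h4 : 0 < ∫ s in (0 : ℝ)..(δ / 2), -(contRep n).poisson s v x := by
    refine intervalIntegral.intervalIntegral_pos_of_pos_on
      (hcont.neg.intervalIntegrable _ _) (fun s hs => ?_) ht
    have := hball s (by
      rw [Metric.mem_ball, Real.dist_eq, sub_zero, abs_of_pos hs.1]
      linarith [hs.2])
    linarith
  rw [intervalIntegral.integral_neg] at h4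
  linarith

lemma IsHalfLaplacian.nonneg_sub_of_isMax {u₁ v₁ u₂ v₂ : Torus n → ℝ}
    (h₁ : IsHalfLaplacian u₁ v₁) (h₂ : IsHalfLaplacian u₂ v₂) {x : Torus n}
    (hx : ∀ y, u₁ y - u₂ y ≤ u₁ x - u₂ x) : 0 ≤ v₁ x - v₂ x := by
  have h := nonneg_of_isMax (u := ⟨u₁, h₁.continuous_left⟩ - ⟨u₂, h₂.continuous_left⟩)
    (v := ⟨v₁, h₁.continuous_right⟩ - ⟨v₂, h₂.continuous_right⟩) (x := x) (fun k => ?_) hx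
  · exact h
  · rw [map_sub, map_sub, contRep_coeff, contRep_coeff, contRep_coeff, contRep_coeff, mul_sub]
    exact congrArg₂ (· - ·) (h₁.coeff k) (h₂.coeff k)

lemma ClassicalRel.differentiableAt {R : ℝ → ℝ → Prop} {φ : Torus n → ℝ → ℝ} {F : ℝ} {J : Set ℝ}
    (hJ : IsOpen J) {g : ℝ → Torus n → ℝ} (h : ClassicalRel R φ F J g) {t : ℝ} (ht : t ∈ J)
    (x : Torus n) : DifferentiableAt ℝ (fun s => g s x) t := by
  obtain ⟨y, rfl⟩ := torusMk_surjective x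
  have h1 := (h.1.differentiableOn one_ne_zero).differentiableAt (x := (t, y))
    ((hJ.prod isOpen_univ).mem_nhds ⟨ht, mem_univ _⟩)
  exact DifferentiableAt.comp (f := fun s : ℝ => (s, y)) t h1 (by fun_prop)

lemma ClassicalRel.mono {R R' : ℝ → ℝ → Prop} (hR : ∀ a b, R a b → R' a b)
    {φ : Torus n → ℝ → ℝ} {F : ℝ} {J J' : Set ℝ} (hJ : J' ⊆ J) {g : ℝ → Torus n → ℝ}
    (h : ClassicalRel R φ F J g) : ClassicalRel R' φ F J' g := by
  obtain ⟨h1, v, h2, h3⟩ := h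
  exact ⟨h1.mono (prod_mono_left hJ), v, h2.mono (prod_mono_left hJ), fun t ht =>
    ⟨(h3 t (hJ ht)).1, fun x => hR _ _ ((h3 t (hJ ht)).2 x)⟩⟩

/-- The comparison principle. -/
theorem comparison {φ : Torus n → ℝ → ℝ} (hφ : IsPinningForce φ) {F T : ℝ}
    {u v : ℝ → Torus n → ℝ} (hu : IsClassicalSubsolution φ F T u)
    (hv : IsClassicalSupersolution φ F T v) (h0 : ∀ x, u 0 x ≤ v 0 x) :
    ∀ t ∈ Ico 0 T, ∀ x, u t x ≤ v t x := by
  intro t₁ ht₁ x₁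
  by_contra hlt
  push Not at hlt
  obtain ⟨K, hK⟩ := hφ.lipschitz
  set L : ℝ := K + 1
  set W : ℝ × Torus n → ℝ := fun p => Real.exp (-(L * p.1)) * (u p.1 p.2 - v p.1 p.2) with hW
  have hsub : Icc 0 t₁ ×ˢ (univ : Set (Torus n)) ⊆ Ico 0 T ×ˢ univ :=
    prod_mono_left fun s hs => ⟨hs.1, hs.2.trans_lt ht₁.2⟩
  have hWc : ContinuousOn W (Icc 0 t₁ ×ˢ univ) :=
    (by fun_prop : Continuous fun p : ℝ × Torus n => Real.exp (-(L * p.1))).continuousOn.mul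
      ((hu.continuousOn.sub hv.continuousOn).mono hsub)
  obtain ⟨⟨t, x⟩, ⟨ht, -⟩, hmax⟩ := (isCompact_Icc.prod isCompact_univ).exists_isMaxOn
    ⟨(t₁, x₁), ⟨ht₁.1, le_rfl⟩, mem_univ _⟩ hWc
  have hmax' : ∀ s ∈ Icc 0 t₁, ∀ y, W (s, y) ≤ W (t, x) := fun s hs y =>
    hmax (show (s, y) ∈ Icc 0 t₁ ×ˢ (univ : Set (Torus n)) from ⟨hs, mem_univ _⟩)
  have hWpos : 0 < W (t, x) :=
    (mul_pos (Real.exp_pos _) (sub_pos.2 hlt)).trans_le (hmax' t₁ ⟨ht₁.1, le_rfl⟩ x₁)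
  have hw : 0 < u t x - v t x := (mul_pos_iff_of_pos_left (Real.exp_pos _)).1 hWpos
  have ht0 : 0 < t := by
    rcases ht.1.eq_or_lt with h | h
    · subst h
      linarith [h0 x]
    · exact h
  have htJ : t ∈ Ioo 0 T := ⟨ht0, ht.2.trans_lt ht₁.2⟩
  have hdu := (hu.subsolution.differentiableAt isOpen_Ioo htJ x).hasDerivAt
  have hdv := (hv.supersolution.differentiableAt isOpen_Ioo htJ x).hasDerivAt
  obtain ⟨-, hu', -, hu''⟩ := hu.subsolution
  obtain ⟨-, hv', -, hv''⟩ := hv.supersolution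
  have hlap : 0 ≤ hu' t x - hv' t x :=
    (hu'' t htJ).1.nonneg_sub_of_isMax (hv'' t htJ).1 fun y =>
      le_of_mul_le_mul_left (hmax' t ht y) (Real.exp_pos _)
  have hde : HasDerivAt (fun s : ℝ => Real.exp (-(L * s))) (Real.exp (-(L * t)) * -(L * 1)) t :=
    ((hasDerivAt_id t).const_mul L).neg.exp
  have hdW := hde.mul (hdu.sub hdv)
  have hineq : deriv (fun s => u s x) t - deriv (fun s => v s x) t ≤ K * (u t x - v t x) := by
    have h1 : deriv (fun s => u s x) t ≤ -hu' t x + φ x (u t x) + F := (hu'' t htJ).2 x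
    have h2 : -hv' t x + φ x (v t x) + F ≤ deriv (fun s => v s x) t := (hv'' t htJ).2 x
    have h3 := (le_abs_self _).trans (abs_sub_le_of_lipschitz hK x (u t x) (v t x))
    rw [abs_of_pos hw] at h3
    linarith
  have hneg : Real.exp (-(L * t)) * -(L * 1) * (u t x - v t x) + Real.exp (-(L * t)) *
      (deriv (fun s => u s x) t - deriv (fun s => v s x) t) < 0 := by
    have h1 : Real.exp (-(L * t)) * -(L * 1) * (u t x - v t x) + Real.exp (-(L * t)) *
        (deriv (fun s => u s x) t - deriv (fun s => v s x) t) = Real.exp (-(L * t)) *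
        (deriv (fun s => u s x) t - deriv (fun s => v s x) t - L * (u t x - v t x)) := by ring
    rw [h1]
    refine mul_neg_of_pos_of_neg (Real.exp_pos _) ?_
    have h2 : L * (u t x - v t x) = K * (u t x - v t x) + (u t x - v t x) := by
      simp only [L]
      ring
    linarith
  have hleft : ∀ᶠ s in 𝓝[<] t, W (s, x) ≤ W (t, x) := by
    filter_upwards [Ioo_mem_nhdsLT ht0] with s hs
    exact hmax' s ⟨hs.1.le, hs.2.le.trans ht.2⟩ x
  have hslope := hdW.hasDerivWithinAt (s := Iio t)
  rw [hasDerivWithinAt_iff_tendsto_slope' (by simp)] at hslope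
  refine absurd hneg (not_lt.2 (ge_of_tendsto hslope ?_))
  filter_upwards [hleft, self_mem_nhdsWithin] with s hs hst
  have hst' : s < t := hst
  rw [slope_def_field]
  exact div_nonneg_of_nonpos (sub_nonpos.2 hs) (sub_nonpos.2 hst'.le)

end Comparison

variable {φ : Torus n → ℝ → ℝ}

/-- Existence of global classical solutions with continuous initial data. -/
theorem exists_isGlobalClassicalSolution (hφ : IsPinningForce φ) (F : ℝ) {g₀ : Torus n → ℝ}
    (hg₀ : Continuous g₀) : ∃ g, IsGlobalClassicalSolution φ F g₀ g := by
  obtain ⟨K, hK⟩ := hφ.lipschitz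
  have hN := lipschitzWith_contForce hφ F hK
  obtain ⟨g, hgc, hg0, hm⟩ := (contRep n).exists_isMildFrom hN ⟨g₀, hg₀⟩
  refine ⟨fun t => g t, ?_, ?_, ?_⟩
  · exact (Continuous.eval (hgc.comp continuous_fst) continuous_snd).continuousOn
  · simp only [hg0, ContinuousMap.coe_mk]
  · exact isClassicalSolutionOn_of_isMildFrom hφ F hgc.continuousOn fun a ha =>
      hm.restart _ (hN.continuous.comp hgc).continuousOn ha.le

lemma IsGlobalClassicalSolution.isClassicalSubsolution {F T : ℝ} {g₀ : Torus n → ℝ}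
    {g : ℝ → Torus n → ℝ} (h : IsGlobalClassicalSolution φ F g₀ g) :
    IsClassicalSubsolution φ F T g where
  continuousOn := h.continuousOn.mono (prod_mono_left Ico_subset_Ici_self)
  subsolution := ClassicalRel.mono (fun _ _ => le_of_eq) Ioo_subset_Ioi_self h.solution

lemma IsGlobalClassicalSolution.isClassicalSupersolution {F T : ℝ} {g₀ : Torus n → ℝ}
    {g : ℝ → Torus n → ℝ} (h : IsGlobalClassicalSolution φ F g₀ g) :
    IsClassicalSupersolution φ F T g where
  continuousOn := h.continuousOn.mono (prod_mono_left Ico_subset_Ici_self)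
  supersolution := ClassicalRel.mono (fun _ _ => ge_of_eq) Ioo_subset_Ioi_self h.solution

lemma IsGlobalClassicalSolution.le (hφ : IsPinningForce φ) {F : ℝ} {g₀ : Torus n → ℝ}
    {g g' : ℝ → Torus n → ℝ} (h : IsGlobalClassicalSolution φ F g₀ g)
    (h' : IsGlobalClassicalSolution φ F g₀ g') {t : ℝ} (ht : 0 ≤ t) (x : Torus n) :
    g t x ≤ g' t x :=
  comparison hφ (T := t + 1) h.isClassicalSubsolution h'.isClassicalSupersolution
    (fun x => by rw [h.initial, h'.initial]) t ⟨ht, by linarith⟩ x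

lemma torusFourierCoeff_force (hφ : IsPinningForce φ) (F : ℝ) (u : L2 n) (k : Fin n → ℤ) :
    torusFourierCoeff (fun x => φ x (u x) + F) k = (l2Rep n).coeff k (l2Force hφ F u) := by
  rw [l2Rep_coeff]
  exact (torusFourierCoeff_congr (l2Force_ae hφ F u) k).symm

/-- Mild solutions in terms of Fourier coefficients are mild solutions in terms of the Poisson
semigroup. -/
lemma isMildSolution_iff (hφ : IsPinningForce φ) (F : ℝ) {g₀ : L2 n} {g : ℝ → L2 n} :
    IsMildSolution φ F g₀ g ↔ ContinuousOn g (Ici 0) ∧ g 0 = g₀ ∧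
      (l2Rep n).IsMildFrom 0 (fun t => l2Force hφ F (g t)) g := by
  obtain ⟨K, hK⟩ := hφ.lipschitz
  have hN := (lipschitzWith_l2Force hφ F hK).continuous
  constructor
  · rintro ⟨hc, hd⟩
    have h0 : g 0 = g₀ := (l2Rep n).ext_coeff fun k => by
      rw [l2Rep_coeff, l2Rep_coeff, hd 0 le_rfl k]
      simp
    refine ⟨hc, h0, fun t ht => (l2Rep n).ext_coeff fun k => ?_⟩
    rw [TorusRep.coeff_variation_of_constants (f := fun t => l2Force hφ F (g t)) _
      (hN.comp_continuousOn hc) ht, l2Rep_coeff, hd t ht k, h0, l2Rep_coeff, sub_zero]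
    simp only [torusFourierCoeff_force hφ]
  · rintro ⟨hc, h0, hm⟩
    refine ⟨hc, fun t ht k => ?_⟩
    rw [← l2Rep_coeff, hm t ht,
      TorusRep.coeff_variation_of_constants (f := fun t => l2Force hφ F (g t)) _
      (hN.comp_continuousOn hc) ht, h0, l2Rep_coeff, sub_zero]
    simp only [torusFourierCoeff_force hφ]

/-- Existence of mild solutions with square integrable initial data. -/
theorem exists_isMildSolution (hφ : IsPinningForce φ) (F : ℝ) (g₀ : L2 n) :
    ∃ g, IsMildSolution φ F g₀ g := by
  obtain ⟨K, hK⟩ := hφ.lipschitz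
  obtain ⟨g, hgc, hg0, hm⟩ := (l2Rep n).exists_isMildFrom (lipschitzWith_l2Force hφ F hK) g₀
  exact ⟨g, (isMildSolution_iff hφ F).2 ⟨hgc.continuousOn, hg0, hm⟩⟩

/-- Mild solutions are classical at positive times. -/
theorem IsMildSolution.exists_isClassicalSolutionOn (hφ : IsPinningForce φ) {F : ℝ} {g₀ : L2 n}
    {g : ℝ → L2 n} (h : IsMildSolution φ F g₀ g) :
    ∃ u : ℝ → Torus n → ℝ, IsClassicalSolutionOn φ F (Ioi 0) u ∧
      ∀ t : ℝ, 0 < t → ∀ᵐ x ∂(Torus.measure n), g t x = u t x := by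
  obtain ⟨hc, -, hm⟩ := (isMildSolution_iff hφ F).1 h
  obtain ⟨G, hGc, hGg, hGm⟩ := exists_continuous_representative hφ F hc hm
  refine ⟨fun t => G t, isClassicalSolutionOn_of_isMildFrom hφ F hGc hGm, fun t ht => ?_⟩
  rw [← hGg t ht]
  exact toL2_ae (G t)

end HalfLaplaceFlow

end

open HalfLaplaceFlow in
theorem proposition3p1 {n : ℕ} (φ : Torus n → ℝ → ℝ) (hφ : IsPinningForce φ)
    (F : ℝ) (hF : 0 ≤ F) :
    -- unique global classical solution for continuous initial data
    (∀ g₀ : Torus n → ℝ, Continuous g₀ →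
      ∃ g : ℝ → Torus n → ℝ, IsGlobalClassicalSolution φ F g₀ g ∧
        ∀ g' : ℝ → Torus n → ℝ, IsGlobalClassicalSolution φ F g₀ g' →
          ∀ t : ℝ, 0 ≤ t → g' t = g t) ∧
    -- comparison principle
    (∀ T : ℝ, ∀ u v : ℝ → Torus n → ℝ,
      IsClassicalSubsolution φ F T u → IsClassicalSupersolution φ F T v →
      (∀ x, u 0 x ≤ v 0 x) → ∀ t ∈ Set.Ico 0 T, ∀ x, u t x ≤ v t x) ∧
    -- square integrable initial data: mild solutions exist, and are classical at positive times
    (∀ g₀ : L2 n,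
      (∃ g : ℝ → L2 n, IsMildSolution φ F g₀ g) ∧
      ∀ g : ℝ → L2 n, IsMildSolution φ F g₀ g →
          ∃ h : ℝ → Torus n → ℝ, IsClassicalSolutionOn φ F (Set.Ioi 0) h ∧
            ∀ t : ℝ, 0 < t → ∀ᵐ x ∂(Torus.measure n), g t x = h t x) := by
  refine ⟨fun g₀ hg₀ => ?_, fun T u v hu hv h0 => comparison hφ hu hv h0, fun g₀ =>
    ⟨exists_isMildSolution hφ F g₀, fun g hg => hg.exists_isClassicalSolutionOn hφ⟩⟩
  obtain ⟨g, hg⟩ := exists_isGlobalClassicalSolution hφ F hg₀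
  exact ⟨g, hg, fun g' hg' t ht => funext fun x =>
    le_antisymm (hg'.le hφ hg ht x) (hg.le hφ hg' ht x)⟩
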